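/- All matroids are finite. A gammoid is a matroid isomorphic to a restriction of a strict gammoid, i.e. of a matroid on the vertex set $V$ of a finite digraph whose independent sets are the sets $X\subseteq V$ that can be linked into a fixed set $B\subseteq V$ by $|X|$ pairwise vertex-disjoint directed paths; a binary gammoid is a gammoid that is representable over $\mathbb F_2$. If a binary matroid $M$ is represented over $\mathbb F_2$ by the matrix $A$ and $H\subseteq E(M)$, the splitting matroid $M_H$ is the vector matroid of the matrix obtained from $A$ by adding one row that is $1$ in the columns labelled by $H$ and $0$ elsewhere (it does not depend on the choice of $A$). For $k\ge 1$ let $\mathcal G_k$ be the class of binary gammoids $M$ for which there is a set $H\subseteq E(M)$ with $|H|=k$ such that $M_H$ is not a binary gammoid; a minimal minor of $\mathcal G_k$ is a member of $\mathcal G_k$ none of whose proper minors is in $\mathcal G_k$. A matroid $P$ is an extension of a matroid $N$ by $m$ elements if $P\backslash X\cong N$ for some $X\subseteq E(P)$ with $|X|=m$. Let $Q_2,Q_3,Q_4$ be the following multigraphs with three vertices and six edges: $Q_2$ is a triangle with two of its sides doubled and with a loop at the vertex common to the two doubled sides; $Q_3$ is a triangle with two of its sides doubled and with a loop at a vertex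 that lies on exactly one doubled side; $Q_4$ is a triangle with all three sides doubled. Let $M(Q_i)$ denote the cycle matroid of $Q_i$. **Theorem.** Let $k\ge 2$ and let $M$ be a binary gammoid with $M\in\mathcal G_k$. Then $M$ has a minor $P$ for which one of the following holds. (i) $P$ is a single-element extension of some minimal minor of the class $\mathcal G_{k-1}$. (ii) For some $i\in\{2,3,4\}$, $P\cong M(Q_i)$ or $P$ is an extension of $M(Q_i)$ by at most $k$ elements. -/

import Mathlib

open Matroid

namespace GammoidSplitting

/-! ### Isomorphism -/

/-- Two matroids are isomorphic if some bijection of their ground sets preserves and reflects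
independence. -/
def Iso {α β : Type*} (M : Matroid α) (N : Matroid β) : Prop :=
  ∃ φ : M.E ≃ N.E, ∀ I : Set M.E,
    M.Indep (Subtype.val '' I) ↔ N.Indep (Subtype.val '' (φ '' I))

/-! ### Vector matroids and binary matroids -/

/-- The vector matroid of the columns of the matrix `A` that are labelled by `E`: the ground set is
the set `E` of column labels, and `I ⊆ E` is independent iff the columns of `A` labelled by `I` are
linearly independent (as a family, so equal columns are parallel and zero columns are loops). -/
noncomputable def vectorMatroid {α ρ K : Type*} [Field K] [Finite ρ] (A : Matrix ρ α K)
    (E : Set α) : Matroid α :=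
  (IndepMatroid.ofBddAugment E (fun I => I ⊆ E ∧ LinearIndepOn K A.col I)
    (indep_empty := ⟨Set.empty_subset _, linearIndepOn_empty _ _⟩)
    (indep_subset := fun _ _ hJ hIJ => ⟨hIJ.trans hJ.1, hJ.2.mono hIJ⟩)
    (indep_aug := by
      rintro I J ⟨hIE, hI⟩ ⟨hJE, hJ⟩ hlt
      by_contra! hcon
      have hspan : Submodule.span K (A.col '' J) ≤ Submodule.span K (A.col '' I) := by
        rw [Submodule.span_le]
        rintro _ ⟨e, heJ, rfl⟩
        by_cases heI : e ∈ I
        · exact Submodule.subset_span ⟨e, heI, rfl⟩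
        by_contra he
        exact hcon e heJ heI (Set.insert_subset_iff.2 ⟨hJE heJ, hIE⟩)
          ((linearIndepOn_insert heI).2 ⟨hI, he⟩)
      have hcard : (Module.rank K (Submodule.span K (A.col '' J))).toENat ≤
          (Module.rank K (Submodule.span K (A.col '' I))).toENat :=
        OrderHom.mono (β := ℕ∞) Cardinal.toENat (Submodule.rank_mono hspan)
      rw [toENat_rank_span_set hJ, toENat_rank_span_set hI] at hcard
      exact absurd hlt (not_lt.2 hcard))
    (indep_bdd := by
      refine ⟨Module.finrank K (ρ → K), fun I hI => ?_⟩
      have h := hI.2.encard_le_toENat_rank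
      rwa [← Module.finrank_eq_rank, Cardinal.toENat_nat] at h)
    (subset_ground := fun _ hI => hI.1)).matroid

@[simp] theorem vectorMatroid_ground {α ρ K : Type*} [Field K] [Finite ρ] (A : Matrix ρ α K)
    (E : Set α) : (vectorMatroid A E).E = E := rfl

@[simp] theorem vectorMatroid_indep {α ρ K : Type*} [Field K] [Finite ρ] (A : Matrix ρ α K)
    (E I : Set α) : (vectorMatroid A E).Indep I ↔ I ⊆ E ∧ LinearIndepOn K A.col I := Iff.rfl

/-- `M` is binary: it is the vector matroid of a matrix over the two-element field. -/
def IsBinary {α : Type*} (M : Matroid α) : Prop :=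
  ∃ (m : ℕ) (A : Matrix (Fin m) α (ZMod 2)), M = vectorMatroid A M.E

/-! ### Gammoids -/

/-- `p` is a directed path of `D` (no repeated vertices, at least one vertex) from `x` to `y`. -/
def IsDirectedPath {V : Type*} (D : Digraph V) (x y : V) (p : List V) : Prop :=
  p.IsChain D.Adj ∧ p.Nodup ∧ p.head? = some x ∧ p.getLast? = some y

/-- `X` is linked into `B` in `D`: there are pairwise vertex-disjoint directed paths, one starting
at each vertex of `X`, all of them ending in `B`. -/
def LinkedInto {V : Type*} (D : Digraph V) (X B : Set V) : Prop :=
  ∃ p : V → List V,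
    (∀ x ∈ X, ∃ y ∈ B, IsDirectedPath D x y (p x)) ∧
    ∀ x ∈ X, ∀ y ∈ X, x ≠ y → (p x).Disjoint (p y)

/-- `M` is a gammoid. The strict gammoid of a finite digraph `D` and a set `B` of its vertices has
ground set `V(D)` and as independent sets the vertex sets that are linked into `B`; a gammoid is a
matroid isomorphic to a restriction of a strict gammoid. Here `f` identifies the ground set of `M`
with a set of vertices of `D`. -/
def IsGammoid {α : Type*} (M : Matroid α) : Prop :=
  ∃ (V : Type) (_ : Finite V) (D : Digraph V) (B : Set V) (f : α → V),
    Set.InjOn f M.E ∧ ∀ I ⊆ M.E, (M.Indep I ↔ LinkedInto D (f '' I) B)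

/-- A binary gammoid is a gammoid that is a binary matroid. -/
def IsBinaryGammoid {α : Type*} (M : Matroid α) : Prop :=
  IsBinary M ∧ IsGammoid M

/-! ### Splitting -/

open Classical in
/-- The matrix `A_H` obtained from `A` by adding a row which is `1` in the columns labelled by `H`
and `0` elsewhere. -/
noncomputable def addRow {α ρ : Type*} (A : Matrix ρ α (ZMod 2)) (H : Set α) :
    Matrix (ρ ⊕ Unit) α (ZMod 2) :=
  Matrix.fromRows A (Matrix.of fun _ e => if e ∈ H then 1 else 0)

/-- `N` is the splitting matroid `M_H` of the binary matroid `M` using the set `H`: the vector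
matroid of `A_H`, for a matrix `A` over the two-element field that represents `M`. It does not
depend on the choice of `A`, see `IsSplitting.unique`. -/
def IsSplitting {α : Type*} (M : Matroid α) (H : Set α) (N : Matroid α) : Prop :=
  ∃ (m : ℕ) (A : Matrix (Fin m) α (ZMod 2)),
    M = vectorMatroid A M.E ∧ N = vectorMatroid (addRow A H) M.E

theorem linearIndepOn_zmod_two_iff {ι W : Type*} [AddCommGroup W] [Module (ZMod 2) W]
    (v : ι → W) (I : Set ι) :
    LinearIndepOn (ZMod 2) v I ↔ ∀ t : Finset ι, (t : Set ι) ⊆ I → ∑ e ∈ t, v e = 0 → t = ∅ := by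
  classical
  rw [linearIndepOn_iff'']
  constructor
  · intro h t ht hs
    by_contra hne
    obtain ⟨e, he⟩ := Finset.nonempty_iff_ne_empty.2 hne
    have := h t (fun i => if i ∈ t then 1 else 0) ht (by simp +contextual)
      (by rw [← hs]; exact Finset.sum_congr rfl (by simp +contextual)) e he
    simp [he] at this
  · intro h t g ht _ hs e he
    by_contra hge
    have key := h (t.filter (fun i => g i ≠ 0)) (fun i hi => ht (by simp at hi; exact hi.1)) (by
      rw [← hs, Finset.sum_filter]
      refine Finset.sum_congr rfl fun i _ => ?_
      have : ∀ x : ZMod 2, x = 0 ∨ x = 1 := by decide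
      rcases this (g i) with h0 | h0 <;> simp [h0])
    have : e ∈ t.filter (fun i => g i ≠ 0) := by simp [he, hge]
    simp [key] at this

theorem sum_col_aux {α ρ σ : Type*} (A : Matrix ρ α (ZMod 2)) (B : Matrix σ α (ZMod 2))
    (E : Set α) (h : ∀ I ⊆ E, LinearIndepOn (ZMod 2) A.col I ↔ LinearIndepOn (ZMod 2) B.col I)
    (n : ℕ) : ∀ t : Finset α, t.card = n → (t : Set α) ⊆ E →
      (∑ e ∈ t, A.col e = 0 ↔ ∑ e ∈ t, B.col e = 0) := by
  classical
  induction n using Nat.strong_induction_on with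
  | _ n ih =>
    intro t htn htE
    have step : ∀ (u : Finset α), u ⊆ t → u ≠ ∅ →
        (∑ e ∈ u, A.col e = 0 ∧ ∑ e ∈ u, B.col e = 0) →
        (∑ e ∈ t, A.col e = 0 ↔ ∑ e ∈ t, B.col e = 0) := by
      rintro u hut hu ⟨hA, hB⟩
      rw [← Finset.sum_sdiff hut, ← Finset.sum_sdiff hut, hA, hB, add_zero, add_zero]
      refine ih (t \ u).card ?_ _ rfl ((Finset.coe_subset.2 Finset.sdiff_subset).trans htE)
      rw [← htn]
      exact Finset.card_lt_card (Finset.sdiff_ssubset hut (Finset.nonempty_iff_ne_empty.2 hu))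
    have small : ∀ (u : Finset α), u ⊆ t → u ≠ t →
        (∑ e ∈ u, A.col e = 0 ↔ ∑ e ∈ u, B.col e = 0) := fun u hut hne =>
      ih u.card (htn ▸ Finset.card_lt_card (hut.ssubset_of_ne hne)) u rfl
        ((Finset.coe_subset.2 hut).trans htE)
    rcases eq_or_ne t ∅ with rfl | ht
    · simp
    constructor
    · intro hA
      have hdep : ¬ LinearIndepOn (ZMod 2) B.col (t : Set α) := fun hB =>
        ht ((linearIndepOn_zmod_two_iff _ _).1 ((h _ htE).2 hB) t subset_rfl hA)
      rw [linearIndepOn_zmod_two_iff] at hdep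
      push Not at hdep
      obtain ⟨u, hut, hu0, hu⟩ := hdep
      rcases eq_or_ne u t with rfl | hne
      · exact hu0
      · have hut' := Finset.coe_subset.1 hut
        exact (step u hut' hu.ne_empty ⟨(small u hut' hne).2 hu0, hu0⟩).1 hA
    · intro hB
      have hdep : ¬ LinearIndepOn (ZMod 2) A.col (t : Set α) := fun hA =>
        ht ((linearIndepOn_zmod_two_iff _ _).1 ((h _ htE).1 hA) t subset_rfl hB)
      rw [linearIndepOn_zmod_two_iff] at hdep
      push Not at hdep
      obtain ⟨u, hut, hu0, hu⟩ := hdep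
      rcases eq_or_ne u t with rfl | hne
      · exact hu0
      · have hut' := Finset.coe_subset.1 hut
        exact (step u hut' hu.ne_empty ⟨hu0, (small u hut' hne).1 hu0⟩).2 hB

theorem IsSplitting.unique {α : Type*} {M : Matroid α} {H : Set α} {N N' : Matroid α}
    (h : IsSplitting M H N) (h' : IsSplitting M H N') : N = N' := by
  classical
  obtain ⟨m, A, hA, rfl⟩ := h
  obtain ⟨n, B, hB, rfl⟩ := h'
  have hAB : ∀ I ⊆ M.E, LinearIndepOn (ZMod 2) A.col I ↔ LinearIndepOn (ZMod 2) B.col I := by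
    intro I hI
    have h1 : M.Indep I ↔ I ⊆ M.E ∧ LinearIndepOn (ZMod 2) A.col I := by
      conv_lhs => rw [hA]
      rfl
    have h2 : M.Indep I ↔ I ⊆ M.E ∧ LinearIndepOn (ZMod 2) B.col I := by
      conv_lhs => rw [hB]
      rfl
    simpa [hI] using h1.symm.trans h2
  have hsum : ∀ {k : ℕ} (C : Matrix (Fin k) α (ZMod 2)) (t : Finset α),
      ∑ e ∈ t, (addRow C H).col e = 0 ↔
        ∑ e ∈ t, C.col e = 0 ∧ ∑ e ∈ t, (if e ∈ H then (1 : ZMod 2) else 0) = 0 := by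
    intro k C t
    simp [funext_iff, Finset.sum_apply, addRow, Matrix.col_apply]
  refine Matroid.ext_indep rfl fun I hI => ?_
  simp only [vectorMatroid_ground] at hI
  simp only [vectorMatroid_indep, linearIndepOn_zmod_two_iff, hsum]
  refine and_congr_right fun _ => forall_congr' fun t => forall_congr' fun ht => ?_
  rw [sum_col_aux A B M.E hAB _ t rfl (ht.trans hI)]

/-- The class `𝒢_k`: binary gammoids for which some splitting using a `k`-element set is not a
binary gammoid. -/
def SplittingClass {α : Type*} (k : ℕ) (M : Matroid α) : Prop :=
  IsBinaryGammoid M ∧ ∃ H ⊆ M.E, H.encard = k ∧ ∃ N, IsSplitting M H N ∧ ¬ IsBinaryGammoid N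

/-- `N` is a minimal minor of `𝒢_k`: it belongs to `𝒢_k`, but none of its proper minors does. -/
def IsMinimalInSplittingClass {α : Type*} (k : ℕ) (N : Matroid α) : Prop :=
  SplittingClass k N ∧ ∀ N', N' <m N → ¬ SplittingClass k N'

/-! ### Cycle matroids of multigraphs -/

/-- The set `I` of edges contains (the edge set of) a cycle of the multigraph `G`: there are
`n + 1 ≥ 1` distinct vertices `v 0, …, v n` and distinct edges `e 0, …, e n` in `I` such that `e i`
joins `v i` and `v (i + 1)`, indices modulo `n + 1`. A loop is a cycle with `n = 0`, a pair of
parallel edges is a cycle with `n = 1`. -/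
def ContainsCycle {V E : Type*} (G : Graph V E) (I : Set E) : Prop :=
  ∃ (n : ℕ) (v : Fin (n + 1) → V) (e : Fin (n + 1) → E),
    Function.Injective v ∧ Function.Injective e ∧
      ∀ i, e i ∈ I ∧ G.IsLink (e i) (v i) (v (i + 1))

open Classical in
/-- The vertex-edge incidence matrix over the two-element field (loops give zero columns). -/
noncomputable def incMatrix {V E : Type*} (G : Graph V E) : Matrix V E (ZMod 2) :=
  Matrix.of fun x e => if ∃ y, G.IsLink e x y ∧ x ≠ y then 1 else 0

theorem incMatrix_col_of_isLink {V E : Type*} [DecidableEq V] (G : Graph V E) {e : E} {x y : V}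
    (h : G.IsLink e x y) :
    (incMatrix G).col e = Pi.single x (1 : ZMod 2) + Pi.single y (1 : ZMod 2) := by
  funext z
  simp only [Matrix.col_apply, incMatrix, Matrix.of_apply, Pi.add_apply, Pi.single_apply]
  by_cases hxy : x = y
  · subst hxy
    rw [CharTwo.add_self_eq_zero, if_neg]
    rintro ⟨w, hw, hne⟩
    rcases h.eq_and_eq_or_eq_and_eq hw with ⟨h1, h2⟩ | ⟨h1, h2⟩ <;>
      exact hne (by rw [← h1, ← h2])
  by_cases hzx : z = x
  · subst hzx
    rw [if_pos ⟨y, h, hxy⟩]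
    simp [hxy]
  by_cases hzy : z = y
  · subst hzy
    rw [if_pos ⟨x, h.symm, Ne.symm hxy⟩]
    simp [hzx]
  rw [if_neg]
  · simp [hzx, hzy]
  rintro ⟨w, hw, -⟩
  rcases h.eq_and_eq_or_eq_and_eq hw with ⟨h1, h2⟩ | ⟨h1, h2⟩
  · exact hzx h1.symm
  · exact hzy h2.symm

theorem containsCycle_of_sum_eq_zero {V E : Type*} [Finite V] (G : Graph V E) (t : Finset E)
    (htG : ∀ e ∈ t, e ∈ G.edgeSet) (ht : t ≠ ∅) (hs : ∑ e ∈ t, (incMatrix G).col e = 0) :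
    ContainsCycle G t := by
  classical
  have hdeg : ∀ e x y, e ∈ t → G.IsLink e x y → x ≠ y →
      ∃ e' z, e' ∈ t ∧ G.IsLink e' y z ∧ e' ≠ e := by
    intro e x y he hl hxy
    by_contra! hcon
    have hy := congrFun hs y
    rw [Finset.sum_apply, Finset.sum_eq_single_of_mem e he] at hy
    · rw [incMatrix_col_of_isLink G hl] at hy
      simp [hxy] at hy
    · intro e' he' hne
      simp only [Matrix.col_apply, incMatrix, Matrix.of_apply]
      rw [if_neg]
      rintro ⟨z, hz, -⟩
      exact hne (hcon e' z he' hz)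
  by_cases hloop : ∃ e ∈ t, ∃ x, G.IsLink e x x
  · obtain ⟨e, he, x, hx⟩ := hloop
    exact ⟨0, fun _ => x, fun _ => e, fun a b _ => by omega,
      fun a b _ => by omega, fun i => ⟨he, hx⟩⟩
  push Not at hloop
  let D := {d : E × V × V // d.1 ∈ t ∧ G.IsLink d.1 d.2.1 d.2.2}
  have hnext : ∀ d : D, ∃ d' : D, d'.1.2.1 = d.1.2.2 ∧ d'.1.1 ≠ d.1.1 := by
    rintro ⟨⟨e, x, y⟩, he, hl⟩
    obtain ⟨e', z, he', hl', hne⟩ := hdeg e x y he hl (by rintro rfl; exact hloop e he _ hl)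
    exact ⟨⟨⟨e', y, z⟩, he', hl'⟩, rfl, hne⟩
  choose next hnext1 hnext2 using hnext
  obtain ⟨e₀, he₀⟩ := Finset.nonempty_iff_ne_empty.2 ht
  obtain ⟨x₀, y₀, hl₀⟩ := (G.edge_mem_iff_exists_isLink e₀).1 (htG e₀ he₀)
  let s : ℕ → D := fun n => next^[n] ⟨⟨e₀, x₀, y₀⟩, he₀, hl₀⟩
  let v : ℕ → V := fun n => (s n).1.2.1
  let e : ℕ → E := fun n => (s n).1.1
  have hs1 : ∀ n, s (n + 1) = next (s n) := fun n => Function.iterate_succ_apply' _ _ _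
  have het : ∀ n, e n ∈ t := fun n => (s n).2.1
  have hlink : ∀ n, G.IsLink (e n) (v n) (v (n + 1)) := by
    intro n
    have h1 : v (n + 1) = (s n).1.2.2 := by simp only [v, hs1, hnext1]
    rw [h1]
    exact (s n).2.2
  have hnb : ∀ n, e (n + 1) ≠ e n := by
    intro n
    simp only [e, hs1]
    exact hnext2 _
  have hrep : ∃ p, ∃ i, v i = v (i + (p + 1)) := by
    obtain ⟨i, j, hne, hij⟩ := Finite.exists_ne_map_eq_of_infinite v
    rcases lt_or_gt_of_ne hne with h | h
    · exact ⟨j - i - 1, i, by rw [hij]; congr 1; omega⟩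
    · exact ⟨i - j - 1, j, by rw [← hij]; congr 1; omega⟩
  classical
  obtain ⟨i, hi⟩ := Nat.find_spec hrep
  have hmin : ∀ q < Nat.find hrep, ∀ j, v j ≠ v (j + (q + 1)) := fun q hq j hj =>
    Nat.find_min hrep hq ⟨j, hj⟩
  generalize Nat.find hrep = p at hi hmin
  have hvlt : ∀ a b : ℕ, a < b → b ≤ a + p → v a ≠ v b := by
    intro a b hab hb h
    refine hmin (b - a - 1) (by omega) a ?_
    rw [h]; congr 1; omega
  have helt : ∀ a b : ℕ, a < b → b ≤ a + p → e a ≠ e b := by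
    intro a b hab hb h
    have hb' := hlink b
    rw [← h] at hb'
    rcases (hlink a).eq_and_eq_or_eq_and_eq hb' with ⟨h1, h2⟩ | ⟨h1, h2⟩
    · exact hvlt a b hab hb h1
    · rcases Nat.lt_or_ge (a + 1) b with hlt | hge
      · exact hvlt (a + 1) b hlt (by omega) h2
      · obtain rfl : b = a + 1 := by omega
        exact hnb a h.symm
  refine ⟨p, fun a => v (i + a), fun a => e (i + a), ?_, ?_, ?_⟩
  · intro a b hab
    rcases lt_trichotomy a b with h | h | h
    · exact absurd hab (hvlt _ _ (by omega) (by omega))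
    · exact h
    · exact absurd hab.symm (hvlt _ _ (by omega) (by omega))
  · intro a b hab
    rcases lt_trichotomy a b with h | h | h
    · exact absurd hab (helt _ _ (by omega) (by omega))
    · exact h
    · exact absurd hab.symm (helt _ _ (by omega) (by omega))
  · intro a
    refine ⟨het _, ?_⟩
    have h := hlink (i + a)
    rcases eq_or_ne a (Fin.last p) with rfl | hne
    · simp only [Fin.val_last] at h
      simp only [Fin.last_add_one, Fin.val_zero, add_zero, Fin.val_last]
      rw [hi]
      exact h
    · have ha := Fin.val_add_one_of_lt (lt_of_le_of_ne (Fin.le_last a) hne)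
      simp only [ha]
      exact h

theorem containsCycle_iff {V E : Type*} [Finite V] (G : Graph V E) (I : Set E)
    (hI : I ⊆ G.edgeSet) :
    ¬ ContainsCycle G I ↔ LinearIndepOn (ZMod 2) (incMatrix G).col I := by
  classical
  rw [linearIndepOn_zmod_two_iff]
  constructor
  · intro h t ht hs
    by_contra hne
    obtain ⟨n, v, e, hv, he, hl⟩ := containsCycle_of_sum_eq_zero G t (fun e he => hI (ht he)) hne hs
    exact h ⟨n, v, e, hv, he, fun i => ⟨ht (hl i).1, (hl i).2⟩⟩
  · rintro h ⟨n, v, e, hv, he, hl⟩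
    have := h (Finset.univ.image e) (by
      intro x hx
      simp only [Finset.coe_image, Finset.coe_univ, Set.image_univ, Set.mem_range] at hx
      obtain ⟨i, rfl⟩ := hx
      exact (hl i).1) (by
      rw [Finset.sum_image (fun a _ b _ hab => he hab)]
      simp only [fun i => incMatrix_col_of_isLink G (hl i).2, Finset.sum_add_distrib]
      have hrot := Equiv.sum_comp (Equiv.addRight (1 : Fin (n + 1)))
        (fun i => (Pi.single (v i) (1 : ZMod 2) : V → ZMod 2))
      simp only [Equiv.coe_addRight] at hrot
      rw [hrot]
      funext x
      exact CharTwo.add_self_eq_zero _)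
    simp [Finset.univ_eq_empty_iff] at this

/-- The cycle matroid `M(G)` of a multigraph `G` with finitely many vertices: its ground set is the
edge set of `G`, and a set of edges is independent iff it contains no cycle. -/
noncomputable def cycleMatroid {V E : Type*} [Finite V] (G : Graph V E) : Matroid E :=
  (Matroid.ofExistsMatroid G.edgeSet (fun I => I ⊆ G.edgeSet ∧ ¬ ContainsCycle G I)
    ⟨vectorMatroid (incMatrix G) G.edgeSet, rfl, fun I => by
      rw [vectorMatroid_indep]
      exact and_congr_right fun hI => (containsCycle_iff G I hI).symm⟩)

@[simp] theorem cycleMatroid_ground {V E : Type*} [Finite V] (G : Graph V E) :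
    (cycleMatroid G).E = G.edgeSet := rfl

theorem cycleMatroid_indep {V E : Type*} [Finite V] (G : Graph V E) (I : Set E) :
    (cycleMatroid G).Indep I ↔ I ⊆ G.edgeSet ∧ ¬ ContainsCycle G I := Iff.rfl

/-! ### The graphs `Q_2`, `Q_3`, `Q_4` -/

/-- The multigraph with vertex set `V` and edge set `E` in which the edge `e` has ends `ends e`. -/
def graphOfEnds {V E : Type*} (ends : E → Sym2 V) : Graph V E where
  vertexSet := Set.univ
  IsLink e x y := ends e = s(x, y)
  edgeSet := Set.univ
  isLink_symm e _ := ⟨fun x y h => h.trans Sym2.eq_swap⟩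
  eq_or_eq_of_isLink_of_isLink e x y v w h h' := by
    have := h.symm.trans h'
    simp only [Sym2.eq_iff] at this
    tauto
  edge_mem_iff_exists_isLink e := by
    simp only [Set.mem_univ, true_iff]
    induction h : ends e using Sym2.ind with
    | _ x y => exact ⟨x, y, rfl⟩
  left_mem_of_isLink := by simp

/-- `Q_2`: a triangle on the vertices `0, 1, 2` with the two sides at the vertex `0` doubled, and a
loop at the vertex `0` (which lies on both doubled sides). -/
def Q₂ : Graph (Fin 3) (Fin 6) :=
  graphOfEnds ![s(1, 2), s(0, 1), s(0, 1), s(0, 2), s(0, 2), s(0, 0)]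

/-- `Q_3`: the same triangle with two doubled sides, and a loop at the vertex `1` (which lies on
just one doubled side). -/
def Q₃ : Graph (Fin 3) (Fin 6) :=
  graphOfEnds ![s(1, 2), s(0, 1), s(0, 1), s(0, 2), s(0, 2), s(1, 1)]

/-- `Q_4`: a triangle with all three sides doubled. -/
def Q₄ : Graph (Fin 3) (Fin 6) :=
  graphOfEnds ![s(1, 2), s(1, 2), s(0, 1), s(0, 1), s(0, 2), s(0, 2)]

end GammoidSplitting

namespace GammoidSplitting

open scoped symmDiff

/-! ### Binary cycle spaces -/

/-! The minor is always `M(Q₂)` or `M(Q₄)` itself, with no added elements, so the second alternative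
of the theorem holds. The key fact is that a binary matroid is a gammoid exactly when it has no
`M(K₄)`-minor.

A splitting matroid is binary, so if it is not a binary gammoid it has an `M(K₄)`-minor, obtained by
contracting some `Y` and keeping six elements. Its cycles are the cycles of `M` that meet `H`
evenly. The same minor of `M` therefore has the cycles of `M(K₄)` and at most one further coset of
them. There must be such a coset, because the gammoid `M` has no `M(K₄)`-minor. So the minor of `M`
is represented by the six columns of `M(K₄)` modulo a nonzero vector `w` of the three-dimensional
space. If `w` is one of the six columns, this is `M(Q₂)`; for the remaining vector it is `M(Q₄)`
(`exists_relabelling`, `SplittingClass.exists_isMinor_iso`).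

A binary matroid without `M(K₄)`-minor reduces to the empty one by removing loops, coloops, parallel
and series elements, since a nonempty simple cosimple binary matroid has an `M(K₄)`-minor
(`hasK4Minor_of_isSimple_of_isCosimple`). Each reduction is undone by adding vertices to a digraph
(`isGammoidSpace_of_not_hasK4Minor`).

Conversely, symmetric exchanges in a gammoid can be chosen with different partners for different
elements (`exists_exchange`), which two complementary bases of `M(K₄)` do not allow
(`IsGammoidSpace.not_hasK4Minor`). Binary matroids are handled through their cycle spaces, and
linkings through matchings (`linkedInto_iff_matchedOff`). -/

/-- `C` is the family of cycles (disjoint unions of circuits) of a binary matroid on `E`. -/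
structure IsCycleSpace {α : Type*} [DecidableEq α] (E : Finset α) (C : Set (Finset α)) : Prop where
  subset : ∀ s ∈ C, s ⊆ E
  empty_mem : ∅ ∈ C
  symmDiff_mem : ∀ s ∈ C, ∀ t ∈ C, s ∆ t ∈ C

/-- Columns of a representation of `M(K₄)` over the two-element field. -/
def k4 : Fin 6 → ZMod 2 × ZMod 2 × ZMod 2 :=
  ![(1, 0, 0), (0, 1, 0), (0, 0, 1), (1, 1, 0), (1, 0, 1), (0, 1, 1)]

/-- The binary matroid on `E` with cycles `C` has an `M(K₄)`-minor, obtained by contracting `Y` and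
restricting to the range of `φ`. -/
def HasK4Minor {α : Type*} [DecidableEq α] (E : Finset α) (C : Set (Finset α)) : Prop :=
  ∃ (φ : Fin 6 ↪ α) (Y : Finset α), Y ⊆ E ∧ (∀ i, φ i ∈ E ∧ φ i ∉ Y) ∧
    ∀ t : Finset (Fin 6), (∃ s ∈ C, s \ Y = t.map φ) ↔ ∑ i ∈ t, k4 i = 0

/-- No loops and no parallel pairs. -/
def IsSimple {α : Type*} (C : Set (Finset α)) : Prop :=
  ∀ s ∈ C, s.card ≤ 2 → s = ∅

/-- No loops and at most one parallel pair. -/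
def IsNearSimple {α : Type*} (C : Set (Finset α)) : Prop :=
  (∀ s ∈ C, s.card ≠ 1) ∧ ∀ s ∈ C, ∀ t ∈ C, s.card = 2 → t.card = 2 → s = t

/-- No coloops and no series pairs. -/
def IsCosimple {α : Type*} (E : Finset α) (C : Set (Finset α)) : Prop :=
  ∀ e ∈ E, (∃ s ∈ C, e ∈ s) ∧ ∀ f ∈ E, e ≠ f → ∃ s ∈ C, e ∈ s ∧ f ∉ s

section CycleSpace

variable {α : Type*} [DecidableEq α] {E : Finset α} {C : Set (Finset α)}

/-! ### Deletion, contraction and recognition of `M(K₄)` -/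

theorem IsCycleSpace.delete (h : IsCycleSpace E C) (e : α) :
    IsCycleSpace (E.erase e) {s ∈ C | e ∉ s} where
  subset s hs x hx := by
    have := h.subset s hs.1 hx
    have := hs.2
    grind
  empty_mem := ⟨h.empty_mem, by simp⟩
  symmDiff_mem s hs t ht := ⟨h.symmDiff_mem s hs.1 t ht.1, by
    have := hs.2; have := ht.2; simp_all [Finset.mem_symmDiff]⟩

theorem IsCycleSpace.contract (h : IsCycleSpace E C) (e : α) :
    IsCycleSpace (E.erase e) ((fun s => s.erase e) '' C) where
  subset := by
    rintro _ ⟨s, hs, rfl⟩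
    exact Finset.erase_subset_erase _ (h.subset s hs)
  empty_mem := ⟨∅, h.empty_mem, by simp⟩
  symmDiff_mem := by
    rintro _ ⟨s, hs, rfl⟩ _ ⟨t, ht, rfl⟩
    refine ⟨s ∆ t, h.symmDiff_mem s hs t ht, ?_⟩
    ext x
    simp only [Finset.mem_symmDiff, Finset.mem_erase]
    tauto

theorem HasK4Minor.of_delete {e : α}
    (h : HasK4Minor (E.erase e) {s ∈ C | e ∉ s}) : HasK4Minor E C := by
  obtain ⟨φ, Y, hY, hφ, ht⟩ := h
  refine ⟨φ, Y, hY.trans (Finset.erase_subset _ _),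
    fun i => ⟨Finset.mem_of_mem_erase (hφ i).1, (hφ i).2⟩, fun t => ?_⟩
  rw [← ht]
  constructor
  · rintro ⟨s, hs, hst⟩
    refine ⟨s, ⟨hs, fun hes => ?_⟩, hst⟩
    have heY : e ∉ Y := fun h => by simpa using hY h
    have : e ∈ t.map φ := by rw [← hst]; simp [hes, heY]
    obtain ⟨i, -, rfl⟩ := Finset.mem_map.1 this
    simpa using (hφ i).1
  · rintro ⟨s, hs, hst⟩
    exact ⟨s, hs.1, hst⟩

theorem HasK4Minor.of_contract {e : α} (he : e ∈ E)
    (h : HasK4Minor (E.erase e) ((fun s => s.erase e) '' C)) : HasK4Minor E C := by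
  obtain ⟨φ, Y, hY, hφ, ht⟩ := h
  refine ⟨φ, insert e Y, Finset.insert_subset he (hY.trans (Finset.erase_subset _ _)),
    fun i => ⟨Finset.mem_of_mem_erase (hφ i).1, ?_⟩, fun t => ?_⟩
  · have h1 := (hφ i).1
    have h2 := (hφ i).2
    grind
  · rw [← ht]
    have (s : Finset α) : s.erase e \ Y = s \ insert e Y := by ext; simp; tauto
    simp [this]

/-- The list is the cycle space of `K₄`, spanned by three triangles. Every vector of the
three-dimensional space is a sum of at most two columns of `k4`, so each set of edges becomes a
cycle after changing at most two of them. -/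
theorem exists_cycle_near (t : Finset (Fin 6)) :
    ∃ u ∈ ([∅, {0, 1, 3}, {0, 2, 4}, {1, 2, 5}, {0, 1, 3} ∆ {0, 2, 4}, {0, 1, 3} ∆ {1, 2, 5},
      {0, 2, 4} ∆ {1, 2, 5}, {0, 1, 3} ∆ ({0, 2, 4} ∆ {1, 2, 5})] : List (Finset (Fin 6))),
      (t ∆ u).card ≤ 2 ∧ (∑ i ∈ t, k4 i = 0 ↔ t ∆ u = ∅) := by
  revert t
  decide +kernel

/-- The triangles generate all cycles of `K₄`. Any further cycle on the six elements would differ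
from one of these in at most two elements, and simplicity forbids that. -/
theorem hasK4Minor_of_triangles (hC : IsCycleSpace E C) (hs : IsSimple C) (φ : Fin 6 ↪ α)
    (h1 : Finset.map φ {0, 1, 3} ∈ C) (h2 : Finset.map φ {0, 2, 4} ∈ C)
    (h3 : Finset.map φ {1, 2, 5} ∈ C) : HasK4Minor E C := by
  have hsub := fun x (hx : x ∈ Finset.map φ {0, 1, 3}) => hC.subset _ h1 hx
  have hsub2 := fun x (hx : x ∈ Finset.map φ {0, 2, 4}) => hC.subset _ h2 hx
  have hsub3 := fun x (hx : x ∈ Finset.map φ {1, 2, 5}) => hC.subset _ h3 hx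
  have hmap : ∀ s t : Finset (Fin 6), (s ∆ t).map φ = s.map φ ∆ t.map φ := fun s t => by
    simp only [Finset.map_eq_image]; exact Finset.image_symmDiff s t φ.injective
  have hmem : ∀ u ∈ ([∅, {0, 1, 3}, {0, 2, 4}, {1, 2, 5}, {0, 1, 3} ∆ {0, 2, 4},
      {0, 1, 3} ∆ {1, 2, 5}, {0, 2, 4} ∆ {1, 2, 5}, {0, 1, 3} ∆ ({0, 2, 4} ∆ {1, 2, 5})] :
      List (Finset (Fin 6))), u.map φ ∈ C := by
    intro u hu
    have h0 : Finset.map φ ∅ ∈ C := by simpa using hC.empty_mem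
    have h23 := hC.symmDiff_mem _ h2 _ h3
    have h12 := hC.symmDiff_mem _ h1 _ h2
    have h13 := hC.symmDiff_mem _ h1 _ h3
    have h123 := hC.symmDiff_mem _ h1 _ h23
    simp only [← hmap] at h23 h12 h13 h123
    simp only [List.mem_cons, List.not_mem_nil, or_false] at hu
    rcases hu with rfl | rfl | rfl | rfl | rfl | rfl | rfl | rfl <;> assumption
  refine ⟨φ, ∅, by simp, fun i => ⟨?_, by simp⟩, fun t => ?_⟩
  · fin_cases i
    · exact hsub _ (by simp)
    · exact hsub _ (by simp)
    · exact hsub2 _ (by simp)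
    · exact hsub _ (by simp)
    · exact hsub2 _ (by simp)
    · exact hsub3 _ (by simp)
  · obtain ⟨u, hu, hcard, hiff⟩ := exists_cycle_near t
    simp only [Finset.sdiff_empty, exists_eq_right, hiff]
    constructor
    · intro ht
      have := hs _ (hC.symmDiff_mem _ ht _ (hmem u hu)) (by rwa [← hmap, Finset.card_map])
      rwa [← hmap, Finset.map_eq_empty] at this
    · intro ht
      rw [symmDiff_eq_bot.1 ht]
      exact hmem u hu

/-! ### Simple cosimple binary matroids contain `M(K₄)` -/

/-- Under cosimplicity of `C`, the failure of cosimplicity of the deletion of `e` exhibits a triad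
containing `e`. -/
theorem exists_triad (hC : IsCycleSpace E C) (hco : IsCosimple E C) {e : α} (he : e ∈ E)
    (hdel : ¬ IsCosimple (E.erase e) {s ∈ C | e ∉ s}) :
    ∃ p ∈ E, ∃ q ∈ E, p ≠ q ∧ e ≠ p ∧ e ≠ q ∧ (∀ s ∈ C, e ∉ s → (p ∈ s ↔ q ∈ s)) ∧
      ∀ s ∈ C, e ∈ s → (p ∈ s ↔ q ∉ s) := by
  have hcol : ∀ p ∈ E, p ≠ e → ∃ s ∈ C, e ∉ s ∧ p ∈ s := fun p hp hpe => by
    obtain ⟨s, hs, h1, h2⟩ := (hco p hp).2 e he hpe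
    exact ⟨s, hs, h2, h1⟩
  unfold IsCosimple at hdel
  push Not at hdel
  obtain ⟨p, hp, hdel⟩ := hdel
  obtain ⟨hpe, hp⟩ := Finset.mem_erase.1 hp
  obtain ⟨s, hs, h1, h2⟩ := hcol p hp hpe
  obtain ⟨q, hq, hpq, himp⟩ := hdel ⟨s, ⟨hs, h1⟩, h2⟩
  obtain ⟨hqe, hq⟩ := Finset.mem_erase.1 hq
  have hiff : ∀ s ∈ C, e ∉ s → (p ∈ s ↔ q ∈ s) := by
    refine fun s hs hes => ⟨himp s ⟨hs, hes⟩, fun hqs => ?_⟩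
    by_contra hps
    obtain ⟨t, ht, het, hpt⟩ := hcol p hp hpe
    have hqt := himp t ⟨ht, het⟩ hpt
    have := himp (s ∆ t) ⟨hC.symmDiff_mem s hs t ht, by simp [Finset.mem_symmDiff, hes, het]⟩
      (by simp [Finset.mem_symmDiff, hpt, hps])
    simp [Finset.mem_symmDiff, hqt, hqs] at this
  refine ⟨p, hp, q, hq, hpq, hpe.symm, hqe.symm, hiff, fun s hs hes => ?_⟩
  -- A cycle separating `p` from `q` must contain `e`; adding it to `s` gives a cycle avoiding `e`,
  -- where `p` and `q` behave alike.
  obtain ⟨t, ht, hpt, hqt⟩ := (hco p hp).2 q hq hpq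
  have het : e ∈ t := by
    by_contra het
    exact hqt ((hiff t ht het).1 hpt)
  have := hiff (s ∆ t) (hC.symmDiff_mem s hs t ht) (by simp [Finset.mem_symmDiff, hes, het])
  simp only [Finset.mem_symmDiff, hpt, hqt] at this
  tauto

/-- Given that nonempty simple cosimple binary matroids on at most `n` elements have
`M(K₄)`-minors, so have the cosimple ones with a single parallel pair. -/
theorem hasK4Minor_of_isNearSimple (n : ℕ)
    (ih : ∀ (E : Finset α) (C : Set (Finset α)), E.card ≤ n → IsCycleSpace E C → E.Nonempty →
      IsSimple C → IsCosimple E C → HasK4Minor E C) (m : ℕ) :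
    ∀ (E : Finset α) (C : Set (Finset α)), E.card = m → m ≤ n → IsCycleSpace E C → E.Nonempty →
      IsNearSimple C → IsCosimple E C → HasK4Minor E C := by
  induction m using Nat.strong_induction_on with
  | _ m ihm =>
  intro E C hm hmn hC hne hns hco
  by_cases hsimple : IsSimple C
  · exact ih E C (hm ▸ hmn) hC hne hsimple hco
  have hsmall : ∀ s ∈ C, s.card ≤ 2 → s ≠ ∅ → s.card = 2 := fun s hs h2 h0 => by
    have h1 := hns.1 s hs
    have := Finset.card_ne_zero.2 (Finset.nonempty_iff_ne_empty.2 h0)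
    omega
  unfold IsSimple at hsimple
  push Not at hsimple
  obtain ⟨s₀, hs₀, hs2, hs0⟩ := hsimple
  obtain ⟨a, b, hab, rfl⟩ := Finset.card_eq_two.1 (hsmall s₀ hs₀ hs2 hs0.ne_empty)
  have haE : a ∈ E := hC.subset _ hs₀ (by simp)
  have hbE : b ∈ E := hC.subset _ hs₀ (by simp)
  have hsimple : ∀ s ∈ C, b ∉ s → s.card ≤ 2 → s = ∅ := by
    intro s hs hbs h2
    by_contra h0
    rw [hns.2 s hs _ hs₀ (hsmall s hs h2 h0) (Finset.card_pair hab)] at hbs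
    simp at hbs
  have hC1 := hC.delete b
  by_cases hco1 : IsCosimple (E.erase b) {s ∈ C | b ∉ s}
  · refine HasK4Minor.of_delete (ih _ _ ?_ hC1 ⟨a, by simp [haE, hab]⟩
      (fun s hs => hsimple s hs.1 hs.2) hco1)
    have := Finset.card_le_card (Finset.erase_subset b E)
    omega
  -- A series pair of the deletion of `b` must involve `a`: otherwise a cycle separating it could be
  -- moved off `b` by adding `{a, b}`.
  have hclaim : ∀ x ∈ E, ∀ y ∈ E, x ≠ y → (∀ s ∈ C, b ∉ s → x ∈ s → y ∈ s) → x ≠ b → y ≠ b →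
      x = a ∨ y = a := by
    intro x hx y hy hxy himp hxb hyb
    by_contra! hcon
    obtain ⟨s, hs, hxs, hys⟩ := (hco x hx).2 y hy hxy
    by_cases hbs : b ∈ s
    · have := himp (s ∆ {a, b}) (hC.symmDiff_mem s hs _ hs₀) (by simp [Finset.mem_symmDiff, hbs])
        (by simp [Finset.mem_symmDiff, hxs, hxb, hcon.1])
      simp [Finset.mem_symmDiff, hys, hyb, hcon.2] at this
    · exact hys (himp s hs hbs hxs)
  obtain ⟨c, hcE, hca, hcb, hac⟩ : ∃ c ∈ E, c ≠ a ∧ c ≠ b ∧ ∀ s ∈ C, b ∉ s → (a ∈ s ↔ c ∈ s) := by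
    obtain ⟨p, hp, q, hq, hpq, hbp, hbq, hiff, -⟩ := exists_triad hC hco hbE hco1
    rcases hclaim p hp q hq hpq (fun s hs hbs => (hiff s hs hbs).1) hbp.symm hbq.symm with rfl | rfl
    · exact ⟨q, hq, hpq.symm, hbq.symm, hiff⟩
    · exact ⟨p, hp, hpq, hbp.symm, fun s hs hbs => (hiff s hs hbs).symm⟩
  -- Delete `b` and contract the series partner `c` of `a`; the result is smaller and again cosimple
  -- with at most one parallel pair.
  refine HasK4Minor.of_delete (HasK4Minor.of_contract
    (show c ∈ E.erase b by simp [hcE, hcb]) ?_)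
  refine ihm _ ?_ _ _ rfl ?_ (hC1.contract c) ⟨a, by simp [haE, hab, hca.symm]⟩ ⟨?_, ?_⟩ ?_
  · rw [← hm]
    exact Finset.card_lt_card ((Finset.erase_subset _ _).trans_ssubset (Finset.erase_ssubset hbE))
  · rw [← hm] at hmn
    exact (Finset.card_le_card ((Finset.erase_subset _ _).trans (Finset.erase_subset _ _))).trans hmn
  · rintro _ ⟨s, ⟨hs, hbs⟩, rfl⟩ h1
    have h2 : s.card ≤ 2 := by
      have := Finset.pred_card_le_card_erase (s := s) (a := c)
      simp only at h1
      omega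
    rw [hsimple s hs hbs h2] at h1
    simp at h1
  -- A parallel pair created by contracting `c` comes from a triangle through `c`, hence through
  -- `a`; two such triangles would differ in at most two elements.
  · have key : ∀ s ∈ C, b ∉ s → (s.erase c).card = 2 → s.card = 3 ∧ a ∈ s ∧ c ∈ s := by
      intro s hs hbs h2
      by_cases hcs : c ∈ s
      · exact ⟨by rw [Finset.card_erase_of_mem hcs] at h2; omega, (hac s hs hbs).2 hcs, hcs⟩
      · rw [Finset.erase_eq_of_notMem hcs] at h2
        rw [hsimple s hs hbs h2.le] at h2
        simp at h2
    rintro _ ⟨s, ⟨hs, hbs⟩, rfl⟩ _ ⟨t, ⟨ht, hbt⟩, rfl⟩ h1 h2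
    obtain ⟨hs3, has, hcs⟩ := key s hs hbs h1
    obtain ⟨ht3, hat, hct⟩ := key t ht hbt h2
    have hst : s ∆ t = ∅ := by
      refine hsimple _ (hC.symmDiff_mem s hs t ht) (by simp [Finset.mem_symmDiff, hbs, hbt]) ?_
      have h3 : ({a, c} : Finset α) ⊆ s := by simp [Finset.insert_subset_iff, has, hcs]
      have h4 : ({a, c} : Finset α) ⊆ t := by simp [Finset.insert_subset_iff, hat, hct]
      have h5 : s ∆ t ⊆ (s \ {a, c}) ∪ (t \ {a, c}) := by
        intro x
        simp only [Finset.mem_symmDiff, Finset.mem_union, Finset.mem_sdiff, Finset.mem_insert,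
          Finset.mem_singleton]
        rintro (⟨h, h'⟩ | ⟨h, h'⟩)
        · left; refine ⟨h, ?_⟩; rintro (rfl | rfl) <;> contradiction
        · right; refine ⟨h, ?_⟩; rintro (rfl | rfl) <;> contradiction
      refine (Finset.card_le_card h5).trans ((Finset.card_union_le _ _).trans ?_)
      rw [Finset.card_sdiff_of_subset h3, Finset.card_sdiff_of_subset h4, hs3, ht3,
        Finset.card_pair hca.symm]
    have : s = t := symmDiff_eq_bot.1 hst
    rw [this]
  · intro e he
    simp only [Finset.mem_erase] at he
    obtain ⟨hec, heb, heE⟩ := he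
    refine ⟨?_, fun f hf hef => ?_⟩
    · obtain ⟨s, hs, hes, hbs⟩ := (hco e heE).2 b hbE heb
      exact ⟨_, ⟨s, ⟨hs, hbs⟩, rfl⟩, by simp [hes, hec]⟩
    · simp only [Finset.mem_erase] at hf
      obtain ⟨hfc, hfb, hfE⟩ := hf
      by_contra! hcon
      have himp : ∀ s ∈ C, b ∉ s → e ∈ s → f ∈ s := fun s hs hbs hes => by
        have := hcon _ ⟨s, ⟨hs, hbs⟩, rfl⟩ (by simp [hes, hec])
        simpa [hfc] using this
      -- A series pair left after contracting `c` contains `a`. Its other element would then be in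
      -- series with `c` too, a pair avoiding `a`.
      rcases hclaim e heE f hfE hef himp heb hfb with rfl | rfl
      · rcases hclaim c hcE f hfE hfc.symm
          (fun s hs hbs hcs => himp s hs hbs ((hac s hs hbs).2 hcs)) hcb hfb with h | h
        · exact hca h
        · exact hef h.symm
      · rcases hclaim e heE c hcE hec
          (fun s hs hbs hes => (hac s hs hbs).1 (himp s hs hbs hes)) heb hcb with h | h
        · exact hef h
        · exact hca h

/-- Two cycles with three elements each in a simple binary matroid meet in at most one element. -/
theorem eq_of_mem_triangles (hC : IsCycleSpace E C) (hs : IsSimple C) {s t : Finset α} (hsC : s ∈ C)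
    (htC : t ∈ C) (hs3 : s.card = 3) (ht3 : t.card = 3) (hst : s ≠ t) {x y : α} (hxs : x ∈ s)
    (hxt : x ∈ t) (hys : y ∈ s) (hyt : y ∈ t) : x = y := by
  by_contra hxy
  refine hst (symmDiff_eq_bot.1 (hs _ (hC.symmDiff_mem s hsC t htC) ?_))
  have h3 : ({x, y} : Finset α) ⊆ s := by simp [Finset.insert_subset_iff, hxs, hys]
  have h4 : ({x, y} : Finset α) ⊆ t := by simp [Finset.insert_subset_iff, hxt, hyt]
  have h5 : s ∆ t ⊆ (s \ {x, y}) ∪ (t \ {x, y}) := by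
    intro z
    simp only [Finset.mem_symmDiff, Finset.mem_union, Finset.mem_sdiff, Finset.mem_insert,
      Finset.mem_singleton]
    rintro (⟨h, h'⟩ | ⟨h, h'⟩)
    · left; refine ⟨h, ?_⟩; rintro (rfl | rfl) <;> contradiction
    · right; refine ⟨h, ?_⟩; rintro (rfl | rfl) <;> contradiction
  refine (Finset.card_le_card h5).trans ((Finset.card_union_le _ _).trans ?_)
  rw [Finset.card_sdiff_of_subset h3, Finset.card_sdiff_of_subset h4, hs3, ht3,
    Finset.card_pair hxy]

theorem exists_third_of_card_eq_three {s : Finset α} (hs : s.card = 3) {x y : α} (hx : x ∈ s)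
    (hy : y ∈ s) (hxy : x ≠ y) : ∃ z, z ≠ x ∧ z ≠ y ∧ s = {x, y, z} := by
  have h : ((s.erase x).erase y).card = 1 := by
    rw [Finset.card_erase_of_mem (by simp [hy, hxy.symm]), Finset.card_erase_of_mem hx, hs]
  obtain ⟨z, hz⟩ := Finset.card_eq_one.1 h
  have hz' : z ∈ (s.erase x).erase y := by simp [hz]
  simp only [Finset.mem_erase] at hz'
  refine ⟨z, hz'.2.1, hz'.1, ?_⟩
  rw [← Finset.insert_erase hx, ← Finset.insert_erase (show y ∈ s.erase x by simp [hy, hxy.symm]),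
    hz]

/-- Every nonempty simple cosimple binary matroid has an `M(K₄)`-minor. -/
theorem hasK4Minor_of_isSimple_of_isCosimple (n : ℕ) :
    ∀ (E : Finset α) (C : Set (Finset α)), E.card ≤ n → IsCycleSpace E C → E.Nonempty →
      IsSimple C → IsCosimple E C → HasK4Minor E C := by
  induction n with
  | zero =>
    intro E C h0 _ hne
    have := hne.card_pos
    omega
  | succ n ih =>
  intro E C hn hC hne hs hco
  by_contra hK
  have hcardlt : ∀ e ∈ E, (E.erase e).card ≤ n := fun e he => by
    rw [Finset.card_erase_of_mem he]; omega
  have hnonempty : ∀ e ∈ E, (E.erase e).Nonempty := by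
    intro e he
    obtain ⟨s, hsC, hes⟩ := (hco e he).1
    by_contra hemp
    rw [Finset.not_nonempty_iff_eq_empty, Finset.erase_eq_empty_iff] at hemp
    have hE1 : E.card ≤ 1 := by rcases hemp with h | h <;> simp [h]
    have := hs s hsC ((Finset.card_le_card (hC.subset s hsC)).trans (by omega))
    simp [this] at hes
  -- Contracting `e` keeps cosimplicity and creates no loop. If at most one parallel pair arose, the
  -- previous theorem would apply, so `e` lies in two triangles.
  have htri : ∀ e ∈ E, ∃ s ∈ C, ∃ t ∈ C, s.card = 3 ∧ t.card = 3 ∧ s ≠ t ∧ e ∈ s ∧ e ∈ t := by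
    intro e he
    have hcard : ∀ s ∈ C, s ≠ ∅ → 3 ≤ s.card := fun s hsC h0 => by
      by_contra h
      exact h0 (hs s hsC (by omega))
    have hcon : ¬ IsNearSimple ((fun s => s.erase e) '' C) := by
      intro hns
      refine hK (HasK4Minor.of_contract he (hasK4Minor_of_isNearSimple n ih _ _ _ rfl
        (hcardlt e he) (hC.contract e) (hnonempty e he) hns ?_))
      intro x hx
      obtain ⟨hxe, hx⟩ := Finset.mem_erase.1 hx
      refine ⟨?_, fun y hy hxy => ?_⟩
      · obtain ⟨s, hsC, hxs⟩ := (hco x hx).1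
        exact ⟨_, ⟨s, hsC, rfl⟩, by simp [hxe, hxs]⟩
      · obtain ⟨s, hsC, hxs, hys⟩ := (hco x hx).2 y (Finset.mem_of_mem_erase hy) hxy
        exact ⟨_, ⟨s, hsC, rfl⟩, by simp [hxe, hxs], by simp [hys]⟩
    have h2 : ∀ s ∈ C, (s.erase e).card = 2 → s.card = 3 ∧ e ∈ s := by
      intro s hsC h2
      by_cases hes : e ∈ s
      · exact ⟨by rw [Finset.card_erase_of_mem hes] at h2; omega, hes⟩
      · rw [Finset.erase_eq_of_notMem hes] at h2
        have := hcard s hsC (by rintro rfl; simp at h2)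
        omega
    by_contra! hno
    refine hcon ⟨?_, ?_⟩
    · rintro _ ⟨s, hsC, rfl⟩ h1
      have h3 := Finset.pred_card_le_card_erase (s := s) (a := e)
      simp only at h1
      have := hcard s hsC (by rintro rfl; simp at h1)
      omega
    · rintro _ ⟨s, hsC, rfl⟩ _ ⟨t, htC, rfl⟩ hs2 ht2
      obtain ⟨hs3, hes⟩ := h2 s hsC hs2
      obtain ⟨ht3, het⟩ := h2 t htC ht2
      by_cases hst : s = t
      · rw [hst]
      · exact absurd het (hno s hsC t htC hs3 ht3 hst hes)
  obtain ⟨e, he⟩ := hne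
  -- Deleting `e` keeps simplicity, so by induction it must destroy cosimplicity, and `e` lies in a
  -- triad.
  obtain ⟨p, hp, q, hq, hpq, hep, heq, hT0, hT1⟩ := exists_triad hC hco he (fun hco' =>
    hK (HasK4Minor.of_delete (ih _ _ (hcardlt e he) (hC.delete e) (hnonempty e he)
      (fun s hsC => hs s hsC.1) hco')))
  -- Each triangle through `e` contains exactly one of `p`, `q`. Two triangles share at most one
  -- element, so both possibilities occur.
  obtain ⟨s₁, hs₁, s₂, hs₂, h31, h32, hne12, hes₁, hes₂, hps₁, hqs₁, hps₂, hqs₂⟩ : ∃ s ∈ C, ∃ t ∈ C,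
      s.card = 3 ∧ t.card = 3 ∧ s ≠ t ∧ e ∈ s ∧ e ∈ t ∧ p ∈ s ∧ q ∉ s ∧ p ∉ t ∧ q ∈ t := by
    obtain ⟨s, hsC, t, htC, hs3, ht3, hst, hes, het⟩ := htri e he
    have h1 := hT1 s hsC hes
    have h2 := hT1 t htC het
    have h3 : p ∈ s → p ∉ t := fun h h' =>
      hep (eq_of_mem_triangles hC hs hsC htC hs3 ht3 hst hes het h h')
    have h4 : q ∈ s → q ∉ t := fun h h' =>
      heq (eq_of_mem_triangles hC hs hsC htC hs3 ht3 hst hes het h h')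
    by_cases hps : p ∈ s
    · exact ⟨s, hsC, t, htC, hs3, ht3, hst, hes, het, by tauto⟩
    · exact ⟨t, htC, s, hsC, ht3, hs3, hst.symm, het, hes, by tauto⟩
  -- Of two triangles through `p`, at most one contains `e`; one that avoids `e` must contain `q`.
  obtain ⟨s₃, hs₃, h33, hes₃, hps₃, hqs₃⟩ : ∃ s ∈ C, s.card = 3 ∧ e ∉ s ∧ p ∈ s ∧ q ∈ s := by
    obtain ⟨s, hsC, t, htC, hs3, ht3, hst, hps, hpt⟩ := htri p hp
    by_cases hes : e ∈ s
    · have het : e ∉ t := fun h =>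
        hep (eq_of_mem_triangles hC hs hsC htC hs3 ht3 hst hes h hps hpt)
      exact ⟨t, htC, ht3, het, hpt, (hT0 t htC het).1 hpt⟩
    · exact ⟨s, hsC, hs3, hes, hps, (hT0 s hsC hes).1 hps⟩
  obtain ⟨b, hbe, hbp, hb⟩ := exists_third_of_card_eq_three h31 hes₁ hps₁ hep
  obtain ⟨d, hde, hdq, hd⟩ := exists_third_of_card_eq_three h32 hes₂ hqs₂ heq
  obtain ⟨g, hgp, hgq, hg⟩ := exists_third_of_card_eq_three h33 hps₃ hqs₃ hpq
  have hbs₁ : b ∈ s₁ := by simp [hb]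
  have hds₂ : d ∈ s₂ := by simp [hd]
  have hgs₃ : g ∈ s₃ := by simp [hg]
  have hbq : b ≠ q := by rintro rfl; exact hqs₁ hbs₁
  have hdp : d ≠ p := by rintro rfl; exact hps₂ hds₂
  have hge : g ≠ e := by rintro rfl; exact hes₃ hgs₃
  have hbd : b ≠ d := by
    rintro rfl
    exact hbe (eq_of_mem_triangles hC hs hs₁ hs₂ h31 h32 hne12 hbs₁ hds₂ hes₁ hes₂)
  have hbg : b ≠ g := by
    rintro rfl
    exact hbp (eq_of_mem_triangles hC hs hs₁ hs₃ h31 h33 (by rintro rfl; exact hes₃ hes₁)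
      hbs₁ hgs₃ hps₁ hps₃)
  have hdg : d ≠ g := by
    rintro rfl
    exact hdq (eq_of_mem_triangles hC hs hs₂ hs₃ h32 h33 (by rintro rfl; exact hes₃ hes₂)
      hds₂ hgs₃ hqs₂ hqs₃)
  -- The triad `e, p, q` becomes the star of a vertex of `K₄`, and `b, d, g` the opposite triangle.
  have hinj : Function.Injective ![e, p, q, b, d, g] := by
    rw [← List.nodup_ofFn]
    simp [hep, heq, hbe.symm, hde.symm, hge.symm, hpq, hbp.symm, hdp.symm, hgp.symm, hbq.symm,
      hdq.symm, hgq.symm, hbd, hbg, hdg]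
  refine hK (hasK4Minor_of_triangles hC hs ⟨![e, p, q, b, d, g], hinj⟩ ?_ ?_ ?_)
  · rw [hb] at hs₁; simpa using hs₁
  · rw [hd] at hs₂; simpa using hs₂
  · rw [hg] at hs₃; simpa using hs₃

end CycleSpace

/-! ### Linkings and matchings -/

/-- `g` matches the vertices outside `B` to themselves or to out-neighbours, avoiding `X`. -/
structure IsMatchingOff {V : Type*} (D : Digraph V) (X B : Set V) (g : V → V) : Prop where
  injOn : Set.InjOn g Bᶜ
  adj : ∀ v ∉ B, g v = v ∨ D.Adj v (g v)
  notMem : ∀ v ∉ B, g v ∉ X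

/-- A matching from the complement of `B` into the complement of `X`, along arcs or loops of `D`. -/
def MatchedOff {V : Type*} (D : Digraph V) (X B : Set V) : Prop :=
  ∃ g : V → V, IsMatchingOff D X B g

section Linking

variable {V : Type*} {D : Digraph V} {X B : Set V}

/-- Send each vertex on a path to its successor and every other vertex to itself. Outside `B`
successors exist, as paths end in `B`; initial vertices are nobody's successor. -/
theorem LinkedInto.matchedOff (h : LinkedInto D X B) : MatchedOff D X B := by
  classical
  obtain ⟨p, hp, hdisj⟩ := h
  have hnext : ∀ v ∉ B, ∃ w, ((∃ x ∈ X, v ∈ p x) →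
      ∃ x ∈ X, ∃ (i : ℕ) (hi : i + 1 < (p x).length), (p x)[i] = v ∧ (p x)[i + 1] = w) ∧
      ((¬ ∃ x ∈ X, v ∈ p x) → w = v) := by
    intro v hv
    by_cases h : ∃ x ∈ X, v ∈ p x
    · obtain ⟨x, hx, hvx⟩ := h
      obtain ⟨i, hi, hiv⟩ := List.getElem_of_mem hvx
      obtain ⟨y, hy, -, -, -, hlast⟩ := hp x hx
      have hi' : i + 1 < (p x).length := by
        by_contra hcon
        have hi'' : i = (p x).length - 1 := by omega
        rw [List.getLast?_eq_getElem?, ← hi'', List.getElem?_eq_getElem hi,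
          Option.some_inj] at hlast
        exact hv (by rw [← hiv, hlast]; exact hy)
      exact ⟨_, fun _ => ⟨x, hx, i, hi', hiv, rfl⟩, fun h => absurd ⟨x, hx, hvx⟩ h⟩
    · exact ⟨v, fun h' => absurd h' h, fun _ => rfl⟩
  choose! g hg1 hg2 using hnext
  have hsame : ∀ x ∈ X, ∀ y ∈ X, ∀ v, v ∈ p x → v ∈ p y → x = y := by
    intro x hx y hy v hvx hvy
    by_contra hne
    exact hdisj x hx y hy hne hvx hvy
  refine ⟨g, ?_, ?_, ?_⟩
  · intro v hv w hw hvw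
    by_cases h1 : ∃ x ∈ X, v ∈ p x <;> by_cases h2 : ∃ x ∈ X, w ∈ p x
    · obtain ⟨x, hx, i, hi, hiv, hiv'⟩ := hg1 v hv h1
      obtain ⟨y, hy, j, hj, hjw, hjw'⟩ := hg1 w hw h2
      obtain rfl := hsame x hx y hy (g v) (by rw [← hiv']; simp) (by rw [hvw, ← hjw']; simp)
      obtain ⟨-, -, -, hnd, -⟩ := hp x hx
      have : i + 1 = j + 1 := (hnd.getElem_inj_iff).1 (by rw [hiv', hjw', hvw])
      obtain rfl : i = j := by omega
      rw [← hiv, ← hjw]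
    · obtain ⟨x, hx, i, hi, hiv, hiv'⟩ := hg1 v hv h1
      rw [hg2 w hw h2] at hvw
      exact absurd ⟨x, hx, by rw [← hvw, ← hiv']; simp⟩ h2
    · obtain ⟨x, hx, i, hi, hiv, hiv'⟩ := hg1 w hw h2
      rw [hg2 v hv h1] at hvw
      exact absurd ⟨x, hx, by rw [hvw, ← hiv']; simp⟩ h1
    · rwa [hg2 v hv h1, hg2 w hw h2] at hvw
  · intro v hv
    by_cases h1 : ∃ x ∈ X, v ∈ p x
    · obtain ⟨x, hx, i, hi, hiv, hiv'⟩ := hg1 v hv h1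
      obtain ⟨-, -, hch, -⟩ := hp x hx
      right
      rw [← hiv', ← hiv]
      exact List.isChain_iff_getElem.1 hch i hi
    · exact Or.inl (hg2 v hv h1)
  · intro v hv hgX
    have hhead : ∀ x ∈ X, ∃ h : 0 < (p x).length, (p x)[0] = x := by
      intro x hx
      obtain ⟨-, -, -, -, hh, -⟩ := hp x hx
      rw [List.head?_eq_getElem?, List.getElem?_eq_some_iff] at hh
      exact hh
    have hself : ∀ x ∈ X, x ∈ p x := fun x hx => List.mem_of_getElem (hhead x hx).2
    by_cases h1 : ∃ x ∈ X, v ∈ p x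
    · obtain ⟨x, hx, i, hi, hiv, hiv'⟩ := hg1 v hv h1
      have hxg := hsame x hx (g v) hgX (g v) (by rw [← hiv']; simp) (hself _ hgX)
      obtain ⟨-, -, -, hnd, -⟩ := hp x hx
      obtain ⟨h0, h0'⟩ := hhead x hx
      have : i + 1 = 0 := (hnd.getElem_inj_iff).1 (by rw [hiv', h0', hxg])
      omega
    · rw [hg2 v hv h1] at hgX
      exact h1 ⟨v, hgX, hself v hgX⟩

/-- Iterate the matching from each vertex of `X` until `B` is reached. Injectivity off `B` and
avoidance of `X` keep the orbits from merging or closing up, and finiteness makes them stop. -/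
theorem MatchedOff.linkedInto [Finite V] (h : MatchedOff D X B) : LinkedInto D X B := by
  classical
  obtain ⟨g, hinj, hadj, hX⟩ := h
  have hcancel : ∀ i, ∀ x ∈ X, ∀ y, (∀ k < i, g^[k] x ∉ B) → (∀ k < i, g^[k] y ∉ B) →
      g^[i] x = g^[i] y → x = y := by
    intro i x hx y hxi hyi hxy
    induction i with
    | zero => simpa using hxy
    | succ i ih =>
      rw [Function.iterate_succ_apply', Function.iterate_succ_apply'] at hxy
      exact ih (fun k hk => hxi k (by omega)) (fun k hk => hyi k (by omega))
        (hinj (hxi i (by omega)) (hyi i (by omega)) hxy)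
  have hnoX : ∀ x y, y ∈ X → ∀ d, (∀ k < d, g^[k] x ∉ B) → y = g^[d] x → d = 0 := by
    intro x y hy d hd hyx
    rcases d with _ | d
    · rfl
    rw [Function.iterate_succ_apply'] at hyx
    exact absurd (hyx ▸ hy) (hX _ (hd d (by omega)))
  -- Cancelling `i` steps leaves `x = g^[j - i] y`; since no step lands in `X`, the exponent is
  -- zero.
  have hkey : ∀ x ∈ X, ∀ y ∈ X, ∀ i j, i ≤ j → (∀ k < i, g^[k] x ∉ B) →
      (∀ k < j, g^[k] y ∉ B) → g^[i] x = g^[j] y → i = j ∧ x = y := by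
    intro x hx y hy i j hij hxi hyj hxy
    have h1 : x = g^[j - i] y := by
      refine hcancel i x hx _ hxi (fun k hk => ?_) ?_
      · rw [← Function.iterate_add_apply]
        exact hyj _ (by omega)
      · rw [← Function.iterate_add_apply, hxy]
        congr 2
        omega
    have h2 := hnoX y x hx (j - i) (fun k hk => hyj k (by omega)) h1
    refine ⟨by omega, ?_⟩
    rw [h2] at h1
    exact h1
  have hreach : ∀ x ∈ X, ∃ n, g^[n] x ∈ B := by
    intro x hx
    by_contra! hcon
    obtain ⟨i, j, hne, hij⟩ := Finite.exists_ne_map_eq_of_infinite (fun n => g^[n] x)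
    rcases le_total i j with h | h
    · exact hne (hkey x hx x hx i j h (fun k _ => hcon k) (fun k _ => hcon k) hij).1
    · exact hne (hkey x hx x hx j i h (fun k _ => hcon k) (fun k _ => hcon k) hij.symm).1.symm
  have hreach' : ∀ x ∈ X, ∃ n, g^[n] x ∈ B ∧ ∀ k < n, g^[k] x ∉ B := fun x hx =>
    ⟨Nat.find (hreach x hx), Nat.find_spec (hreach x hx), fun k hk => Nat.find_min _ hk⟩
  choose! n hn hmin using hreach'
  have hij : ∀ x ∈ X, ∀ y ∈ X, ∀ i ≤ n x, ∀ j ≤ n y, g^[i] x = g^[j] y → i = j ∧ x = y := by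
    intro x hx y hy i hi j hj h
    rcases le_total i j with hle | hle
    · exact hkey x hx y hy i j hle (fun k hk => hmin x hx k (by omega))
        (fun k hk => hmin y hy k (by omega)) h
    · have := hkey y hy x hx j i hle (fun k hk => hmin y hy k (by omega))
        (fun k hk => hmin x hx k (by omega)) h.symm
      exact ⟨this.1.symm, this.2.symm⟩
  refine ⟨fun x => (List.range (n x + 1)).map (fun i => g^[i] x), fun x hx =>
    ⟨g^[n x] x, hn x hx, ?_, ?_, ?_, ?_⟩, fun x hx y hy hne => ?_⟩
  · rw [List.isChain_iff_getElem]
    intro i hi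
    simp only [List.length_map, List.length_range] at hi
    simp only [List.getElem_map, List.getElem_range]
    rw [Function.iterate_succ_apply']
    refine (hadj _ (hmin x hx i (by omega))).resolve_left fun h => ?_
    rw [← Function.iterate_succ_apply' g] at h
    have := (hij x hx x hx (i + 1) (by omega) i (by omega) h).1
    omega
  · refine List.Nodup.map_on ?_ List.nodup_range
    intro i hi j hj h
    simp only [List.mem_range] at hi hj
    exact (hij x hx x hx i (by omega) j (by omega) h).1
  · simp [List.head?_eq_getElem?]
  · rw [List.getLast?_map, List.getLast?_range]
    simp
  · intro v hv hv'
    simp only [List.mem_map, List.mem_range] at hv hv'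
    obtain ⟨i, hi, rfl⟩ := hv
    obtain ⟨j, hj, h⟩ := hv'
    exact hne (hij x hx y hy i (by omega) j (by omega) h.symm).2

/-- The Ingleton–Piff duality between strict gammoids and transversal matroids. Matchings, unlike
path systems, can be recombined freely. -/
theorem linkedInto_iff_matchedOff [Finite V] : LinkedInto D X B ↔ MatchedOff D X B :=
  ⟨LinkedInto.matchedOff, MatchedOff.linkedInto⟩

/-- The digraph obtained from `D` by adding a vertex with arcs to the vertices in `S`. -/
def addVertex (D : Digraph V) (S : Set V) : Digraph (Option V) where
  Adj x y := match x, y with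
    | none, some s => s ∈ S
    | some v, some w => D.Adj v w
    | _, none => False

/-- No arc enters the new vertex, so old vertices have old partners. -/
theorem IsMatchingOff.of_addVertex {S : Set V} {X' B' : Set (Option V)} {g : Option V → Option V}
    (hg : IsMatchingOff (addVertex D S) X' B' g) :
    ∃ h : V → V, (∀ v, some v ∉ B' → g (some v) = some (h v)) ∧
      IsMatchingOff D (some ⁻¹' X') (some ⁻¹' B') h := by
  have h : ∀ v, ∃ w, some v ∉ B' → g (some v) = some w := by
    intro v
    by_cases hv : some v ∈ B'
    · exact ⟨v, fun h => absurd hv h⟩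
    rcases hw : g (some v) with _ | w
    · have := hg.adj _ hv
      simp [hw, addVertex] at this
    · exact ⟨w, fun _ => rfl⟩
  choose h hh using h
  refine ⟨h, hh, fun v hv w hw hvw => ?_, fun v hv => ?_, fun v hv => ?_⟩
  · have := hg.injOn hv hw (by rw [hh v hv, hh w hw, hvw])
    simpa using this
  · have := hg.adj _ hv
    simpa [hh v hv, addVertex] using this
  · have := hg.notMem _ hv
    rwa [hh v hv] at this

/-- A vertex of the target needs no partner, whether or not it is to be linked. -/
theorem matchedOff_addVertex_of_mem {S : Set V} {X' B' : Set (Option V)} (hB : none ∈ B') :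
    MatchedOff (addVertex D S) X' B' ↔ MatchedOff D (some ⁻¹' X') (some ⁻¹' B') := by
  constructor
  · rintro ⟨g, hg⟩
    obtain ⟨h, -, hh⟩ := hg.of_addVertex
    exact ⟨h, hh⟩
  · rintro ⟨h, hh⟩
    refine ⟨Option.map h, ?_, ?_, ?_⟩
    · rintro (_ | v) hv (_ | w) hw hvw
      · rfl
      · exact absurd hB hv
      · exact absurd hB hw
      · rw [hh.injOn hv hw (by simpa using hvw)]
    · rintro (_ | v) hv
      · exact absurd hB hv
      · simpa [addVertex] using hh.adj v hv
    · rintro (_ | v) hv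
      · exact absurd hB hv
      · exact hh.notMem v hv

/-- The new vertex can be matched to itself. -/
theorem matchedOff_addVertex_of_notMem {S : Set V} {X' B' : Set (Option V)}
    (hX : none ∉ X') :
    MatchedOff (addVertex D S) X' B' ↔ MatchedOff D (some ⁻¹' X') (some ⁻¹' B') := by
  constructor
  · rintro ⟨g, hg⟩
    obtain ⟨h, -, hh⟩ := hg.of_addVertex
    exact ⟨h, hh⟩
  · rintro ⟨h, hh⟩
    refine ⟨Option.map h, ?_, ?_, ?_⟩
    · rintro (_ | v) hv (_ | w) hw hvw
      · rfl
      · simp at hvw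
      · simp at hvw
      · rw [hh.injOn hv hw (by simpa using hvw)]
    · rintro (_ | v) hv
      · simp
      · simpa [addVertex] using hh.adj v hv
    · rintro (_ | v) hv
      · exact hX
      · exact hh.notMem v hv

/-- The new vertex cannot be its own partner, so it takes some `y ∈ S`, which is then forbidden to
all others as if it belonged to `X'`. -/
theorem matchedOff_addVertex_of_notMem_of_mem {S : Set V} {X' B' : Set (Option V)} (hB : none ∉ B')
    (hX : none ∈ X') :
    MatchedOff (addVertex D S) X' B' ↔
      ∃ y ∈ S, some y ∉ X' ∧ MatchedOff D (insert y (some ⁻¹' X')) (some ⁻¹' B') := by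
  constructor
  · rintro ⟨g, hg⟩
    obtain ⟨h, hgh, hh⟩ := hg.of_addVertex
    have h1 := hg.adj _ hB
    have h2 := hg.notMem _ hB
    rcases hy : g none with _ | y
    · rw [hy] at h2
      exact absurd hX h2
    rw [hy] at h1 h2
    refine ⟨y, by simpa [addVertex] using h1, h2, h, hh.injOn, hh.adj, fun v hv => ?_⟩
    rintro (hvy | hvX)
    · have := hg.injOn hB hv (by rw [hgh v hv, hy, hvy])
      simp at this
    · exact hh.notMem v hv hvX
  · rintro ⟨y, hyS, hyX, h, hh⟩
    refine ⟨fun x => x.elim (some y) (fun v => some (h v)), ?_, ?_, ?_⟩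
    · rintro (_ | v) hv (_ | w) hw hvw
      · rfl
      · exact absurd (Or.inl (by simpa using hvw.symm)) (hh.notMem w hw)
      · exact absurd (Or.inl (by simpa using hvw)) (hh.notMem v hv)
      · rw [hh.injOn hv hw (by simpa using hvw)]
    · rintro (_ | v) hv
      · simpa [addVertex] using hyS
      · simpa [addVertex] using hh.adj v hv
    · rintro (_ | v) hv
      · exact hyX
      · exact fun hX => hh.notMem v hv (Or.inr hX)

/-- Exchange in a strict gammoid: an element of `Q \ P` can be added to `P`, or else exchanged
against some element of `P \ Q` in both `P` and `Q`; for different elements of `Q \ P` the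
elements of `P \ Q` so obtained differ. -/
theorem exists_exchange {P Q : Set V} (hP : MatchedOff D P B) (hQ : MatchedOff D Q B) :
    ∃ ρ : V → V → Prop, (∀ y ∈ Q \ P, MatchedOff D (insert y P) B ∨
      ∃ x ∈ P \ Q, ρ y x ∧ MatchedOff D (insert y (P \ {x})) B ∧
        MatchedOff D (insert x (Q \ {y})) B) ∧
      ∀ y ∈ Q, ∀ y' ∈ Q, ∀ x, ρ y x → ρ y' x → y = y' := by
  classical
  obtain ⟨g, hg⟩ := hP
  obtain ⟨h, hh⟩ := hQ
  -- The steps from `g b` to `h b` form a partial injection whose orbits are alternating paths.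
  -- Elements of `P` have no successor and elements of `Q` no predecessor.
  let r : V → V → Prop := fun u v => ∃ b ∉ B, g b = u ∧ h b = v
  have hru : Relator.RightUnique r := by
    rintro _ v w ⟨b, hb, rfl, rfl⟩ ⟨b', hb', h1, rfl⟩
    rw [hg.injOn hb' hb h1]
  have hrl : Relator.RightUnique (Function.swap r) := by
    rintro _ v w ⟨b, hb, rfl, rfl⟩ ⟨b', hb', rfl, h1⟩
    rw [hh.injOn hb' hb h1]
  have hQend : ∀ y z, Relation.ReflTransGen r y z → z ∈ Q → y = z := by
    intro y z hyz hz
    rcases Relation.ReflTransGen.cases_tail hyz with rfl | ⟨w, -, b, hb, -, rfl⟩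
    · rfl
    · exact absurd hz (hh.notMem b hb)
  have hPstart : ∀ x z, x ∈ P → Relation.ReflTransGen r x z → x = z := by
    intro x z hx hxz
    rcases Relation.ReflTransGen.cases_head hxz with rfl | ⟨w, ⟨b, hb, rfl, -⟩, -⟩
    · rfl
    · exact absurd hx (hg.notMem b hb)
  have hback : ∀ y ∈ Q, ∀ b ∉ B, Relation.ReflTransGen r y (h b) →
      Relation.ReflTransGen r y (g b) := by
    intro y hy b hb hyb
    rcases Relation.ReflTransGen.cases_tail hyb with h1 | ⟨w, hyw, b', hb', rfl, h1⟩
    · exact absurd (h1 ▸ hy) (hh.notMem b hb)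
    · rwa [hh.injOn hb' hb h1] at hyw
  have hforw : ∀ y, ∀ b ∉ B, Relation.ReflTransGen r y (g b) →
      Relation.ReflTransGen r y (h b) := fun y b hb hyb => hyb.tail ⟨b, hb, rfl, rfl⟩
  refine ⟨Relation.ReflTransGen r, fun y hy => ?_, fun y hy y' hy' x hyx hyx' => ?_⟩
  · obtain ⟨hyQ, hyP⟩ := hy
    -- Interchange the two matchings along the orbit of `y`: in `k` this frees `y` and uses at most
    -- the end of the orbit in `P`; `l` is the complementary choice.
    set k : V → V := fun b => if Relation.ReflTransGen r y (g b) then h b else g b with hk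
    set l : V → V := fun b => if Relation.ReflTransGen r y (g b) then g b else h b with hl
    have hkinj : Set.InjOn k Bᶜ := by
      intro b hb c hc hbc
      simp only [hk] at hbc
      split_ifs at hbc with h1 h2 h2
      · exact hh.injOn hb hc hbc
      · exact absurd (hbc ▸ hforw y b hb h1) h2
      · exact absurd (hbc ▸ hforw y c hc h2) h1
      · exact hg.injOn hb hc hbc
    have hlinj : Set.InjOn l Bᶜ := by
      intro b hb c hc hbc
      simp only [hl] at hbc
      split_ifs at hbc with h1 h2 h2
      · exact hg.injOn hb hc hbc
      · exact absurd (hback y hyQ c hc (hbc ▸ h1)) h2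
      · exact absurd (hback y hyQ b hb (hbc ▸ h2)) h1
      · exact hh.injOn hb hc hbc
    have hkadj : ∀ v ∉ B, k v = v ∨ D.Adj v (k v) := by
      intro v hv
      simp only [hk]
      split_ifs
      · exact hh.adj v hv
      · exact hg.adj v hv
    have hladj : ∀ v ∉ B, l v = v ∨ D.Adj v (l v) := by
      intro v hv
      simp only [hl]
      split_ifs
      · exact hg.adj v hv
      · exact hh.adj v hv
    by_cases hx : ∃ x ∈ P, Relation.ReflTransGen r y x
    · obtain ⟨x, hxP, hyx⟩ := hx
      have hxQ : x ∉ Q := fun hxQ => hyP (hQend y x hyx hxQ ▸ hxP)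
      refine Or.inr ⟨x, ⟨hxP, hxQ⟩, hyx, ⟨k, hkinj, hkadj, fun v hv => ?_⟩,
        ⟨l, hlinj, hladj, fun v hv => ?_⟩⟩
      · simp only [hk]
        split_ifs with h1
        · have h2 := hforw y v hv h1
          rintro (h3 | ⟨h3, h4⟩)
          · exact hh.notMem v hv (h3 ▸ hyQ)
          · rcases Relation.ReflTransGen.total_of_right_unique hru hyx h2 with h5 | h5
            · exact h4 (hPstart x _ hxP h5).symm
            · exact h4 (hPstart _ x h3 h5)
        · rintro (h3 | ⟨h3, -⟩)
          · exact h1 (h3 ▸ Relation.ReflTransGen.refl)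
          · exact hg.notMem v hv h3
      · simp only [hl]
        split_ifs with h1
        · rintro (h3 | ⟨h3, h4⟩)
          · exact hg.notMem v hv (h3 ▸ hxP)
          · exact h4 (hQend y _ h1 h3).symm
        · rintro (h3 | ⟨h3, -⟩)
          · exact h1 (hback y hyQ v hv (h3 ▸ hyx))
          · exact hh.notMem v hv h3
    · push Not at hx
      refine Or.inl ⟨k, hkinj, hkadj, fun v hv => ?_⟩
      simp only [hk]
      split_ifs with h1
      · have h2 := hforw y v hv h1
        rintro (h3 | h3)
        · exact hh.notMem v hv (h3 ▸ hyQ)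
        · exact hx _ h3 h2
      · rintro (h3 | h3)
        · exact h1 (h3 ▸ Relation.ReflTransGen.refl)
        · exact hg.notMem v hv h3
  -- Going back from `x` is deterministic and stops on reaching `Q`, so the source is unique.
  · have h1 := Relation.ReflTransGen.total_of_right_unique hrl
      (Relation.reflTransGen_swap.2 hyx) (Relation.reflTransGen_swap.2 hyx')
    rcases h1 with h1 | h1
    · exact (hQend _ _ (Relation.reflTransGen_swap.1 h1) hy).symm
    · exact hQend _ _ (Relation.reflTransGen_swap.1 h1) hy'

end Linking

/-! ### Binary matroids without `M(K₄)`-minors are gammoids -/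

/-- `I` contains no nonempty cycle. -/
def IsAcyclic {α : Type*} (C : Set (Finset α)) (I : Finset α) : Prop :=
  ∀ s ∈ C, s ⊆ I → s = ∅

/-- The binary matroid on `E` with cycles `C` is a gammoid. -/
def IsGammoidSpace {α : Type*} (E : Finset α) (C : Set (Finset α)) : Prop :=
  ∃ (V : Type) (_ : Finite V) (D : Digraph V) (B : Set V) (f : α → V),
    Set.InjOn f E ∧ ∀ I ⊆ E, (IsAcyclic C I ↔ MatchedOff D (f '' I) B)

theorem isAcyclic_delete_iff {α : Type*} {C : Set (Finset α)} {e : α} {I : Finset α} (he : e ∉ I) :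
    IsAcyclic {s ∈ C | e ∉ s} I ↔ IsAcyclic C I :=
  ⟨fun h s hs hsI => h s ⟨hs, fun hes => he (hsI hes)⟩ hsI, fun h s hs hsI => h s hs.1 hsI⟩

section Extension

variable {α : Type*} [DecidableEq α] {E : Finset α} {C : Set (Finset α)}

/-- Label `e` by the new point of `Option V`. -/
def labelNone {V : Type*} (f : α → V) (e : α) : α → Option V :=
  fun x => if x = e then none else some (f x)

theorem none_mem_labelNone_image {V : Type*} (f : α → V) (e : α) (I : Finset α) :
    none ∈ labelNone f e '' (I : Set α) ↔ e ∈ I := by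
  simp [labelNone]

theorem preimage_labelNone_image {V : Type*} (f : α → V) (e : α) (I : Finset α) :
    some ⁻¹' (labelNone f e '' (I : Set α)) = f '' (I.erase e : Finset α) := by
  ext v
  simp only [labelNone, Set.mem_preimage, Set.mem_image, Finset.mem_coe, Finset.mem_erase]
  constructor
  · rintro ⟨x, hx, h⟩
    split_ifs at h with h1
    exact ⟨x, ⟨h1, hx⟩, Option.some_inj.1 h⟩
  · rintro ⟨x, ⟨h1, hx⟩, h⟩
    exact ⟨x, hx, by rw [if_neg h1, h]⟩

theorem injOn_labelNone {V : Type*} {f : α → V} {e : α}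
    (hf : Set.InjOn f (E.erase e : Finset α)) : Set.InjOn (labelNone f e) (E : Set α) := by
  intro x hx y hy hxy
  simp only [labelNone] at hxy
  split_ifs at hxy with h1 h2 h2
  · rw [h1, h2]
  · exact hf (by simpa [h1] using hx) (by simpa [h2] using hy) (Option.some_inj.1 hxy)

theorem preimage_some_image {V : Type*} (B : Set V) : some ⁻¹' (some '' B) = B :=
  Set.preimage_image_eq B (Option.some_injective V)

theorem preimage_some_insert_none {V : Type*} (B : Set V) :
    some ⁻¹' (insert none (some '' B)) = B := by
  ext v
  simp

/-- A vertex outside the target with no outgoing arc is a loop. -/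
theorem IsGammoidSpace.of_delete_loop {e : α} (he : {e} ∈ C)
    (h : IsGammoidSpace (E.erase e) {s ∈ C | e ∉ s}) : IsGammoidSpace E C := by
  obtain ⟨V, hV, D, B, f, hf, hI⟩ := h
  refine ⟨Option V, inferInstance, addVertex D ∅, some '' B, labelNone f e, injOn_labelNone hf,
    fun I hIE => ?_⟩
  by_cases heI : e ∈ I
  · rw [matchedOff_addVertex_of_notMem_of_mem (by simp) ((none_mem_labelNone_image _ _ _).2 heI)]
    simp only [Set.mem_empty_iff_false, false_and, exists_false, iff_false]
    intro hac
    simpa using hac {e} he (by simpa using heI)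
  · rw [matchedOff_addVertex_of_notMem fun h => heI ((none_mem_labelNone_image _ _ _).1 h),
      preimage_labelNone_image, preimage_some_image, ← hI _ (Finset.erase_subset_erase _ hIE),
      Finset.erase_eq_of_notMem heI, isAcyclic_delete_iff heI]

/-- A target vertex that no arc enters is a coloop. -/
theorem IsGammoidSpace.of_delete_coloop {e : α} (he : ∀ s ∈ C, e ∉ s)
    (h : IsGammoidSpace (E.erase e) {s ∈ C | e ∉ s}) : IsGammoidSpace E C := by
  obtain ⟨V, hV, D, B, f, hf, hI⟩ := h
  refine ⟨Option V, inferInstance, addVertex D ∅, insert none (some '' B), labelNone f e,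
    injOn_labelNone hf, fun I hIE => ?_⟩
  rw [matchedOff_addVertex_of_mem (by simp), preimage_labelNone_image, preimage_some_insert_none,
    ← hI _ (Finset.erase_subset_erase _ hIE), isAcyclic_delete_iff (by simp)]
  exact ⟨fun h s hs hsI => h s hs (hsI.trans (Finset.erase_subset _ _)),
    fun h s hs hsI => h s hs (Finset.subset_erase.2 ⟨hsI, he s hs⟩)⟩

/-- Adding `{e, p}` to a cycle through `p` brings it back inside `I`. -/
theorem isAcyclic_exchange (hC : IsCycleSpace E C) {e p : α} (hp : {e, p} ∈ C) (hep : e ≠ p)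
    {I : Finset α} (heI : e ∈ I) (hpI : p ∉ I) (h : IsAcyclic C I) :
    IsAcyclic C (insert p (I.erase e)) := by
  intro s hs hsI
  by_cases hps : p ∈ s
  · have h1 := h (s ∆ {e, p}) (hC.symmDiff_mem s hs _ hp) (by
      intro x hx
      simp only [Finset.mem_symmDiff, Finset.mem_insert, Finset.mem_singleton] at hx
      rcases hx with ⟨hx, hx'⟩ | ⟨rfl | rfl, hx'⟩
      · have := hsI hx
        simp only [Finset.mem_insert, Finset.mem_erase] at this
        tauto
      · exact heI
      · exact absurd hps hx')
    have h2 : s = {e, p} := symmDiff_eq_bot.1 h1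
    have := hsI (show e ∈ s by simp [h2])
    simp [hep] at this
  · refine h s hs fun x hx => ?_
    have := hsI hx
    simp only [Finset.mem_insert, Finset.mem_erase] at this
    rcases this with rfl | h
    · exact absurd hx hps
    · exact h.2

/-- The new vertex lies outside the target and its only arc leads to the vertex of `p`, so linking
it amounts to linking `p`. -/
theorem IsGammoidSpace.of_delete_parallel (hC : IsCycleSpace E C) {e p : α} (hp : {e, p} ∈ C)
    (hep : e ≠ p) (h : IsGammoidSpace (E.erase e) {s ∈ C | e ∉ s}) : IsGammoidSpace E C := by
  obtain ⟨V, hV, D, B, f, hf, hI⟩ := h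
  have hpE : p ∈ E.erase e := by simp [hep.symm, hC.subset _ hp (show p ∈ {e, p} by simp)]
  refine ⟨Option V, inferInstance, addVertex D {f p}, some '' B, labelNone f e, injOn_labelNone hf,
    fun I hIE => ?_⟩
  by_cases heI : e ∈ I
  · rw [matchedOff_addVertex_of_notMem_of_mem (by simp) ((none_mem_labelNone_image _ _ _).2 heI)]
    simp only [Set.mem_singleton_iff, exists_eq_left]
    have hIE' := Finset.erase_subset_erase e hIE
    rw [← Set.mem_preimage, preimage_labelNone_image, preimage_some_image, ← Set.image_insert_eq,
      ← Finset.coe_insert, ← hI _ (Finset.insert_subset hpE hIE'), isAcyclic_delete_iff (by simp [hep]),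
      hf.mem_image_iff (Finset.coe_subset.2 hIE') hpE]
    simp only [Finset.coe_erase, Set.mem_sdiff, Finset.mem_coe, Set.mem_singleton_iff, hep.symm,
      not_false_eq_true, and_true]
    constructor
    · intro hac
      have hpI : p ∉ I := fun hpI => by
        have := hac {e, p} hp (by simp [Finset.insert_subset_iff, heI, hpI])
        simp at this
      exact ⟨hpI, isAcyclic_exchange hC hp hep heI hpI hac⟩
    · rintro ⟨hpI, hac⟩
      have := isAcyclic_exchange hC (by rwa [Finset.pair_comm]) hep.symm
        (Finset.mem_insert_self p _) (by simp [hep]) hac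
      rwa [Finset.erase_insert (by simp [hpI]), Finset.insert_erase heI] at this
  · rw [matchedOff_addVertex_of_notMem fun h => heI ((none_mem_labelNone_image _ _ _).1 h),
      preimage_labelNone_image, preimage_some_image, ← hI _ (Finset.erase_subset_erase _ hIE),
      Finset.erase_eq_of_notMem heI, isAcyclic_delete_iff heI]

/-- Every cycle contains both or neither of `e` and `p`. Hence only the presence of both in `I`
matters, and `p ∈ J` records it. -/
theorem isAcyclic_contract_iff {e p : α} (hs : ∀ s ∈ C, e ∈ s ↔ p ∈ s) (hep : e ≠ p)
    {I J : Finset α} (hJe : e ∉ J) (hJ : ∀ x, x ≠ e → x ≠ p → (x ∈ J ↔ x ∈ I))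
    (hJp : p ∈ J ↔ e ∈ I ∧ p ∈ I) :
    IsAcyclic ((fun s => s.erase e) '' C) J ↔ IsAcyclic C I := by
  constructor
  · intro h s hsC hsI
    have h1 : s.erase e = ∅ := by
      refine h _ ⟨s, hsC, rfl⟩ fun x hx => ?_
      obtain ⟨hxe, hx⟩ := Finset.mem_erase.1 hx
      by_cases hxp : x = p
      · rw [hxp] at hx ⊢
        exact hJp.2 ⟨hsI ((hs s hsC).2 hx), hsI hx⟩
      · exact (hJ x hxe hxp).2 (hsI hx)
    by_cases hes : e ∈ s
    · have : p ∈ s.erase e := by simp [hep.symm, ← hs s hsC, hes]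
      simp [h1] at this
    · rwa [Finset.erase_eq_of_notMem hes] at h1
  · rintro h _ ⟨s, hsC, rfl⟩ hsJ
    have : s = ∅ := by
      refine h s hsC fun x hx => ?_
      by_cases hps : p ∈ s
      · obtain ⟨h1, h2⟩ := hJp.1 (hsJ (by simp [hep.symm, hps]))
        by_cases hxe : x = e
        · rwa [hxe]
        · by_cases hxp : x = p
          · rwa [hxp]
          · exact (hJ x hxe hxp).1 (hsJ (by simp [hxe, hx]))
      · have hxe : x ≠ e := by rintro rfl; exact hps ((hs s hsC).1 hx)
        have hxp : x ≠ p := by rintro rfl; exact hps hx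
        exact (hJ x hxe hxp).1 (hsJ (by simp [hxe, hx]))
    simp [this]

/-- The new vertex for `e` lies in the target. The new vertex for `p` has arcs to it and to the old
vertex `f p`, which loses its label. Without `e` in the set, `p` is linked freely through the vertex
of `e`; with `e`, it must use `f p`, as in the contraction. -/
theorem IsGammoidSpace.of_contract_series {e p : α} (hpE : p ∈ E) (hep : e ≠ p)
    (hs : ∀ s ∈ C, e ∈ s ↔ p ∈ s)
    (h : IsGammoidSpace (E.erase e) ((fun s => s.erase e) '' C)) : IsGammoidSpace E C := by
  obtain ⟨V, hV, D, B, f, hf, hI⟩ := h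
  have hpE' : p ∈ E.erase e := by simp [hep.symm, hpE]
  refine ⟨Option (Option V), inferInstance, addVertex (addVertex D ∅) {none, some (f p)},
    some '' (insert none (some '' B)), labelNone (labelNone f e) p, injOn_labelNone
      (injOn_labelNone (hf.mono ?_)), fun I hIE => ?_⟩
  · exact Finset.coe_subset.2 (Finset.erase_subset_erase _ (Finset.erase_subset _ _))
  have hJE : (I.erase p).erase e ⊆ E.erase e := fun x hx => by
    simp only [Finset.mem_erase] at hx ⊢
    exact ⟨hx.1, hIE hx.2.2⟩
  have hac : ¬ (e ∈ I ∧ p ∈ I) → (IsAcyclic C I ↔ MatchedOff D (f '' ((I.erase p).erase e : Finset α)) B) := by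
    intro h
    rw [← hI _ hJE]
    refine (isAcyclic_contract_iff hs hep (by simp) (fun x hxe hxp => ?_) ?_).symm
    · simp [hxe, hxp]
    · simpa using h
  by_cases hpI : p ∈ I
  · rw [matchedOff_addVertex_of_notMem_of_mem (by simp) ((none_mem_labelNone_image _ _ _).2 hpI)]
    simp only [Set.mem_insert_iff, Set.mem_singleton_iff, exists_eq_or_imp, exists_eq_left]
    rw [matchedOff_addVertex_of_mem (by simp), matchedOff_addVertex_of_mem (by simp),
      preimage_some_image, preimage_some_insert_none]
    have hnone : some ⁻¹' insert none (labelNone f e '' (I.erase p : Finset α)) =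
        f '' ((I.erase p).erase e : Finset α) := by
      rw [← preimage_labelNone_image f e (I.erase p)]
      ext v
      simp
    have hsome : some ⁻¹' insert (some (f p)) (labelNone f e '' (I.erase p : Finset α)) =
        f '' (insert p ((I.erase p).erase e) : Finset α) := by
      rw [Finset.coe_insert, Set.image_insert_eq, ← preimage_labelNone_image f e (I.erase p)]
      ext v
      simp
    have hpn : some (f p) ∉ labelNone f e '' (I.erase p : Finset α) := by
      rw [← Set.mem_preimage, preimage_labelNone_image,
        hf.mem_image_iff (Finset.coe_subset.2 hJE) hpE']
      simp
    have hpre := preimage_labelNone_image (labelNone f e) p I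
    have hmem : ∀ y, some y ∈ labelNone (labelNone f e) p '' (I : Set α) ↔
        y ∈ labelNone f e '' (I.erase p : Finset α) := fun y => by rw [← hpre]; rfl
    rw [hpre, hmem, hmem, hnone, hsome, none_mem_labelNone_image]
    simp only [hpn, not_false_eq_true, true_and]
    by_cases heI : e ∈ I
    · simp only [Finset.mem_erase, ne_eq, hep, not_false_eq_true, heI, and_self, not_true_eq_false,
        false_and, false_or]
      rw [← hI _ (Finset.insert_subset hpE' hJE)]
      refine (isAcyclic_contract_iff hs hep (by simp [hep]) (fun x hxe hxp => ?_) ?_).symm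
      · simp [hxe, hxp]
      · simp [heI, hpI]
    · rw [hac fun h => heI h.1]
      refine ⟨fun h => Or.inl ⟨fun h => heI (Finset.mem_of_mem_erase h), h⟩, ?_⟩
      rintro (h | ⟨g, hg⟩)
      · exact h.2
      · exact ⟨g, hg.injOn, hg.adj, fun v hv h => hg.notMem v hv
          (Set.image_mono (Finset.coe_subset.2 (Finset.subset_insert _ _)) h)⟩
  · rw [matchedOff_addVertex_of_notMem fun h => hpI ((none_mem_labelNone_image _ _ _).1 h),
      preimage_labelNone_image, preimage_some_image, matchedOff_addVertex_of_mem (by simp),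
      preimage_labelNone_image, preimage_some_insert_none]
    exact hac fun h => hpI h.2

/-- A binary matroid without `M(K₄)`-minor is a gammoid. -/
theorem isGammoidSpace_of_not_hasK4Minor (n : ℕ) :
    ∀ (E : Finset α) (C : Set (Finset α)), E.card = n → IsCycleSpace E C → ¬ HasK4Minor E C →
      IsGammoidSpace E C := by
  induction n with
  | zero =>
    intro E C h0 hC hK
    rw [Finset.card_eq_zero] at h0
    subst h0
    refine ⟨Unit, inferInstance, ⟨fun _ _ => False⟩, Set.univ, fun _ => (), by simp, fun I hI => ?_⟩
    rw [Finset.subset_empty.1 hI]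
    exact ⟨fun _ => ⟨id, by simp, by simp, by simp⟩, fun _ s _ hs => Finset.subset_empty.1 hs⟩
  | succ n ih =>
  intro E C hn hC hK
  have hcard : ∀ e ∈ E, (E.erase e).card = n := fun e he => by
    rw [Finset.card_erase_of_mem he, hn]; rfl
  have hdel : ∀ e ∈ E, IsGammoidSpace (E.erase e) {s ∈ C | e ∉ s} := fun e he =>
    ih _ _ (hcard e he) (hC.delete e) fun h => hK h.of_delete
  by_cases hs : IsSimple C
  -- With loops and parallel pairs excluded, the absence of an `M(K₄)`-minor forces a coloop or a
  -- series pair.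
  · have hco : ¬ IsCosimple E C := fun hco => hK (hasK4Minor_of_isSimple_of_isCosimple _ E C le_rfl hC
      (Finset.card_pos.1 (by omega)) hs hco)
    by_cases hcol : ∃ e ∈ E, ∀ s ∈ C, e ∉ s
    · obtain ⟨e, he, hes⟩ := hcol
      exact IsGammoidSpace.of_delete_coloop hes (hdel e he)
    push Not at hcol
    unfold IsCosimple at hco
    push Not at hco
    obtain ⟨e, he, hco⟩ := hco
    obtain ⟨p, hp, hep, himp⟩ := hco (hcol e he)
    refine IsGammoidSpace.of_contract_series hp hep (fun s hsC => ⟨himp s hsC, fun hps => ?_⟩)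
      (ih _ _ (hcard e he) (hC.contract e) fun h => hK (h.of_contract he))
    by_contra hes
    obtain ⟨t, ht, het⟩ := hcol e he
    have := himp _ (hC.symmDiff_mem s hsC t ht) (by simp [Finset.mem_symmDiff, hes, het])
    simp [Finset.mem_symmDiff, hps, himp t ht het] at this
  · unfold IsSimple at hs
    push Not at hs
    obtain ⟨s, hsC, hs2, hs0⟩ := hs
    have hcases : s.card = 1 ∨ s.card = 2 := by
      have := hs0.card_pos
      omega
    rcases hcases with h1 | h2
    · obtain ⟨e, rfl⟩ := Finset.card_eq_one.1 h1
      exact IsGammoidSpace.of_delete_loop hsC (hdel e (hC.subset _ hsC (by simp)))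
    · obtain ⟨e, p, hep, rfl⟩ := Finset.card_eq_two.1 h2
      exact IsGammoidSpace.of_delete_parallel hC hsC hep (hdel e (hC.subset _ hsC (by simp)))

end Extension

/-! ### Minors of gammoids -/

theorem MatchedOff.anti {V : Type*} {D : Digraph V} {X X' B : Set V} (h : MatchedOff D X B)
    (hX : X' ⊆ X) : MatchedOff D X' B := by
  obtain ⟨g, hg⟩ := h
  exact ⟨g, hg.injOn, hg.adj, fun v hv hv' => hg.notMem v hv (hX hv')⟩

section Minor

variable {α : Type*} [DecidableEq α] {E : Finset α} {C : Set (Finset α)}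

/-- If `J` is a maximal acyclic subset of `Y`, then the independent sets of the contraction of `Y`
are the sets `t` for which `t ∪ J` is independent. -/
theorem isAcyclic_union_iff (hC : IsCycleSpace E C) {J Y t : Finset α} (hJY : J ⊆ Y)
    (htY : Disjoint t Y)
    (hJ : IsAcyclic C J) (hmax : ∀ y ∈ Y, y ∉ J → ¬ IsAcyclic C (insert y J)) :
    IsAcyclic C (t ∪ J) ↔ ∀ s ∈ C, s \ Y ⊆ t → s \ Y = ∅ := by
  -- A cycle can be altered inside `Y` until it meets `Y` only in `J`: adding the fundamental
  -- circuit of `y` over `J` removes `y` and changes nothing outside `Y`.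
  have hred : ∀ n, ∀ s ∈ C, ((s ∩ Y) \ J).card = n →
      ∃ s' ∈ C, s' \ Y = s \ Y ∧ (s' ∩ Y) \ J = ∅ := by
    intro n
    induction n with
    | zero => exact fun s hs h0 => ⟨s, hs, rfl, Finset.card_eq_zero.1 h0⟩
    | succ n ih =>
      intro s hs hn
      obtain ⟨y, hy⟩ := Finset.card_pos.1 (show 0 < ((s ∩ Y) \ J).card by omega)
      simp only [Finset.mem_sdiff, Finset.mem_inter] at hy
      obtain ⟨⟨hys, hyY⟩, hyJ⟩ := hy
      have := hmax y hyY hyJ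
      unfold IsAcyclic at this
      push Not at this
      obtain ⟨r, hr, hrJ, hr0⟩ := this
      have hyr : y ∈ r := by
        by_contra hyr
        exact hr0.ne_empty (hJ r hr ((Finset.subset_insert_iff_of_notMem hyr).1 hrJ))
      have hrY : ∀ x ∈ r, x ∈ Y := fun x hx => by
        rcases Finset.mem_insert.1 (hrJ hx) with rfl | h
        · exact hyY
        · exact hJY h
      have hrJ' : ∀ x ∈ r, x = y ∨ x ∈ J := fun x hx => Finset.mem_insert.1 (hrJ hx)
      have h1 : ((s ∆ r) ∩ Y) \ J = ((s ∩ Y) \ J).erase y := by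
        ext x
        have := hrJ' x
        simp only [Finset.mem_sdiff, Finset.mem_inter, Finset.mem_symmDiff, Finset.mem_erase]
        by_cases hxy : x = y
        · subst hxy; tauto
        · tauto
      have h2 : (s ∆ r) \ Y = s \ Y := by
        ext x
        have := hrY x
        simp only [Finset.mem_sdiff, Finset.mem_symmDiff]
        tauto
      obtain ⟨s', hs', h3, h4⟩ := ih _ (hC.symmDiff_mem s hs r hr) (by
        rw [h1, Finset.card_erase_of_mem (by simp [hys, hyY, hyJ]), hn]; rfl)
      exact ⟨s', hs', h3.trans h2, h4⟩
  constructor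
  · intro h s hs hst
    obtain ⟨s', hs', h1, h2⟩ := hred _ s hs rfl
    have : s' = ∅ := by
      refine h s' hs' fun x hx => ?_
      by_cases hxY : x ∈ Y
      · by_contra hxJ
        have : x ∈ (s' ∩ Y) \ J := by
          simp only [Finset.mem_union, not_or] at hxJ
          simp [hx, hxY, hxJ]
        simp [h2] at this
      · exact Finset.mem_union_left _ (hst (h1 ▸ (by simp [hx, hxY])))
    rw [← h1, this]
    simp
  · intro h s hs hst
    have h1 := h s hs (fun x hx => by
      obtain ⟨hx, hxY⟩ := Finset.mem_sdiff.1 hx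
      exact (Finset.mem_union.1 (hst hx)).resolve_right fun hxJ => hxY (hJY hxJ))
    rw [Finset.sdiff_eq_empty_iff_subset] at h1
    refine hJ s hs fun x hx => ?_
    exact (Finset.mem_union.1 (hst hx)).resolve_left fun hxt =>
      Finset.disjoint_left.1 htY hxt (h1 hx)

theorem isAcyclic_map_union_iff {ι : Type*} (hC : IsCycleSpace E C) {J Y : Finset α} (hJY : J ⊆ Y)
    (hJ : IsAcyclic C J) (hmax : ∀ y ∈ Y, y ∉ J → ¬ IsAcyclic C (insert y J)) (φ : ι ↪ α)
    (hφY : ∀ i, φ i ∉ Y) {K : Finset ι → Prop} (hK : ∀ t, (∃ s ∈ C, s \ Y = t.map φ) ↔ K t)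
    (T : Finset ι) : IsAcyclic C (T.map φ ∪ J) ↔ ∀ u ⊆ T, K u → u = ∅ := by
  rw [isAcyclic_union_iff hC hJY (by
    rw [Finset.disjoint_left]
    intro x hx
    obtain ⟨i, -, rfl⟩ := Finset.mem_map.1 hx
    exact hφY i) hJ hmax]
  constructor
  · intro h u huT hu
    obtain ⟨s, hs, hsu⟩ := (hK u).2 hu
    have := h s hs (hsu ▸ Finset.map_subset_map.2 huT)
    rwa [hsu, Finset.map_eq_empty] at this
  · intro h s hs hsT
    obtain ⟨u, huT, hsu⟩ := Finset.subset_map_iff.1 hsT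
    rw [hsu, h u huT ((hK u).1 ⟨s, hs, hsu⟩), Finset.map_empty]

/-- Gammoids have no `M(K₄)`-minors. -/
theorem IsGammoidSpace.not_hasK4Minor (hC : IsCycleSpace E C) (h : IsGammoidSpace E C) :
    ¬ HasK4Minor E C := by
  classical
  rintro ⟨φ, Y, hYE, hφ, hK⟩
  obtain ⟨V, hV, D, B, f, hf, hI⟩ := h
  obtain ⟨J, hJ⟩ := Finset.exists_maximal (s := Y.powerset.filter (IsAcyclic C))
    ⟨∅, Finset.mem_filter.2 ⟨by simp, fun s _ hs => Finset.subset_empty.1 hs⟩⟩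
  have hJY : J ⊆ Y := by simpa using (Finset.mem_filter.1 hJ.prop).1
  have hJE := hJY.trans hYE
  have hacJ : IsAcyclic C J := (Finset.mem_filter.1 hJ.prop).2
  have hmax : ∀ y ∈ Y, y ∉ J → ¬ IsAcyclic C (insert y J) := fun y hy hyJ hac =>
    hyJ (hJ.le_of_ge (y := insert y J) (by simp [Finset.insert_subset_iff, hy, hJY, hac])
      (Finset.subset_insert _ _) (Finset.mem_insert_self _ _))
  set F : Finset (Fin 6) → Set V := fun T => f '' ((T.map φ ∪ J : Finset α) : Set α) with hF
  have hFiff : ∀ T, MatchedOff D (F T) B ↔ ∀ u ⊆ T, ∑ i ∈ u, k4 i = 0 → u = ∅ := by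
    intro T
    rw [← isAcyclic_map_union_iff hC hJY hacJ hmax φ (fun i => (hφ i).2) hK, hI]
    refine Finset.union_subset (fun x hx => ?_) hJE
    obtain ⟨i, -, rfl⟩ := Finset.mem_map.1 hx
    exact (hφ i).1
  have hFmem : ∀ T v, v ∈ F T ↔ (∃ i ∈ T, v = f (φ i)) ∨ v ∈ f '' J := by
    intro T v
    simp only [hF, Finset.coe_union, Set.image_union, Set.mem_union, Finset.coe_map,
      Set.image_image]
    simp [eq_comm]
  have hinj : ∀ i j, f (φ i) = f (φ j) → i = j := fun i j hij =>
    φ.injective (hf (hφ i).1 (hφ j).1 hij)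
  have hnotJ : ∀ i, f (φ i) ∉ f '' J := by
    rintro i ⟨x, hx, hxi⟩
    exact (hφ i).2 (hJY (hf (hJE hx) (hφ i).1 hxi ▸ hx))
  have hdep : ∀ T X, F T ⊆ X → (∃ u ⊆ T, ∑ i ∈ u, k4 i = 0 ∧ u ≠ ∅) → ¬ MatchedOff D X B := by
    rintro T X hTX ⟨u, hu, hu0, hne⟩ hX
    exact hne ((hFiff T).1 (hX.anti hTX) u hu hu0)
  -- Two complementary bases of `M(K₄)`, each enlarged by the basis `J` of the contracted set.
  obtain ⟨ρ, hρ1, hρ2⟩ := exists_exchange (P := F {0, 1, 5}) (Q := F {2, 3, 4})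
    ((hFiff _).2 (by decide +kernel)) ((hFiff _).2 (by decide +kernel))
  have hsub : ∀ a b (S T : Finset (Fin 6)), T ⊆ insert a (S.erase b) →
      F T ⊆ insert (f (φ a)) (F S \ {f (φ b)}) := by
    intro a b S T hT v hv
    rcases (hFmem T v).1 hv with ⟨i, hi, rfl⟩ | hv
    · rcases Finset.mem_insert.1 (hT hi) with rfl | hi
      · exact Or.inl rfl
      · exact Or.inr ⟨(hFmem S _).2 (Or.inl ⟨i, Finset.mem_of_mem_erase hi, rfl⟩),
          fun h => Finset.ne_of_mem_erase hi (hinj i b h)⟩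
    · exact Or.inr ⟨(hFmem S _).2 (Or.inr hv), fun h => hnotJ b (h ▸ hv)⟩
  have hmem : ∀ i T, f (φ i) ∈ F T ↔ i ∈ T := by
    intro i T
    rw [hFmem]
    exact ⟨fun h => h.elim (fun ⟨j, hj, hij⟩ => hinj i j hij ▸ hj) fun h => absurd h (hnotJ i),
      fun h => Or.inl ⟨i, h, rfl⟩⟩
  -- Both `2` and `3` can be exchanged symmetrically only against `1`: every other choice completes
  -- a triangle in one of the two sets. This contradicts the distinctness of partners.
  have hpartner : ∀ j, j ∈ ({2, 3} : Finset (Fin 6)) → ρ (f (φ j)) (f (φ 1)) := by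
    intro j hj
    have hj' : j = 2 ∨ j = 3 := by simpa using hj
    rcases hρ1 (f (φ j)) ⟨(hmem _ _).2 (by rcases hj' with rfl | rfl <;> decide),
      fun h => absurd ((hmem _ _).1 h) (by rcases hj' with rfl | rfl <;> decide)⟩ with h | ⟨x, ⟨hxP, hxQ⟩, hρ, h1, h2⟩
    · exfalso
      rcases hj' with rfl | rfl
      · exact hdep {1, 2, 5} _ (hsub 2 0 {0, 1, 5} _ (by decide)) (by decide +kernel)
          (h.anti (Set.insert_subset_insert Set.sdiff_subset))
      · exact hdep {0, 1, 3} _ (hsub 3 5 {0, 1, 5} _ (by decide)) (by decide +kernel)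
          (h.anti (Set.insert_subset_insert Set.sdiff_subset))
    · rcases (hFmem _ _).1 hxP with ⟨i, hi, rfl⟩ | hxJ
      · have hi' : i = 0 ∨ i = 1 ∨ i = 5 := by simpa using hi
        rcases hi' with rfl | rfl | rfl
        · exfalso
          rcases hj' with rfl | rfl
          · exact hdep {1, 2, 5} _ (hsub 2 0 {0, 1, 5} _ (by decide)) (by decide +kernel) h1
          · exact hdep {0, 2, 4} _ (hsub 0 3 {2, 3, 4} _ (by decide)) (by decide +kernel) h2
        · exact hρ
        · exfalso
          rcases hj' with rfl | rfl
          · exact hdep {3, 4, 5} _ (hsub 5 2 {2, 3, 4} _ (by decide)) (by decide +kernel) h2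
          · exact hdep {0, 1, 3} _ (hsub 3 5 {0, 1, 5} _ (by decide)) (by decide +kernel) h1
      · exact absurd ((hFmem _ _).2 (Or.inr hxJ)) hxQ
  have := hinj _ _ (hρ2 _ ((hmem 2 _).2 (by decide)) _ ((hmem 3 _).2 (by decide)) _
    (hpartner 2 (by decide)) (hpartner 3 (by decide)))
  exact absurd this (by decide)

end Minor

/-! ### Matroids given by cycle spaces -/

/-- The matroid `M` on the finite set `E` has independent sets the subsets of `E` that contain no
nonempty member of `C`. -/
structure HasCycles {α : Type*} (M : Matroid α) (E : Finset α) (C : Set (Finset α)) : Prop where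
  ground : M.E = E
  indep_iff : ∀ I ⊆ E, M.Indep I ↔ IsAcyclic C I

theorem HasCycles.isGammoid_iff {α : Type*} {M : Matroid α} {E : Finset α} {C : Set (Finset α)}
    (h : HasCycles M E C) : IsGammoid M ↔ IsGammoidSpace E C := by
  constructor
  · rintro ⟨V, hV, D, B, f, hf, hI⟩
    rw [h.ground] at hf hI
    exact ⟨V, hV, D, B, f, hf, fun I hIE => by
      rw [← h.indep_iff I hIE, hI I (Finset.coe_subset.2 hIE), linkedInto_iff_matchedOff]⟩
  · rintro ⟨V, hV, D, B, f, hf, hI⟩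
    refine ⟨V, hV, D, B, f, by rwa [h.ground], fun I hIE => ?_⟩
    rw [h.ground] at hIE
    lift I to Finset α using E.finite_toSet.subset hIE
    rw [h.indep_iff I (Finset.coe_subset.1 hIE), hI I (Finset.coe_subset.1 hIE),
      linkedInto_iff_matchedOff]

/-- The cycles inside `E` of the vector matroid of `A`. -/
def vectorCycles {α ρ : Type*} (A : Matrix ρ α (ZMod 2)) (E : Finset α) : Set (Finset α) :=
  {s | s ⊆ E ∧ ∑ e ∈ s, A.col e = 0}

theorem sum_symmDiff_zmod_two {ι W : Type*} [DecidableEq ι] [AddCommGroup W] [Module (ZMod 2) W]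
    (f : ι → W) (s t : Finset ι) : ∑ i ∈ s ∆ t, f i = ∑ i ∈ s, f i + ∑ i ∈ t, f i := by
  have h2 : ∀ x : W, x + x = 0 := fun x => ZModModule.add_self x
  have h1 : ∑ i ∈ s ∆ t, f i = ∑ i ∈ s \ t, f i + ∑ i ∈ t \ s, f i :=
    Finset.sum_union disjoint_sdiff_sdiff
  rw [h1, ← Finset.sum_inter_add_sum_sdiff s t, ← Finset.sum_inter_add_sum_sdiff t s,
    Finset.inter_comm t s]
  have := h2 (∑ i ∈ s ∩ t, f i)
  calc _ = (∑ i ∈ s ∩ t, f i + ∑ i ∈ s ∩ t, f i) + (∑ i ∈ s \ t, f i + ∑ i ∈ t \ s, f i) := by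
        rw [this, zero_add]
    _ = _ := by abel

theorem isCycleSpace_vectorCycles {α ρ : Type*} [DecidableEq α] (A : Matrix ρ α (ZMod 2))
    (E : Finset α) : IsCycleSpace E (vectorCycles A E) where
  subset _ hs := hs.1
  empty_mem := ⟨by simp, by simp⟩
  symmDiff_mem s hs t ht := ⟨fun x hx => by
    rcases Finset.mem_symmDiff.1 hx with h | h
    · exact hs.1 h.1
    · exact ht.1 h.1, by rw [sum_symmDiff_zmod_two, hs.2, ht.2, add_zero]⟩

theorem hasCycles_vectorMatroid {α ρ : Type*} [Finite ρ] (A : Matrix ρ α (ZMod 2))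
    (E : Finset α) : HasCycles (vectorMatroid A E) E (vectorCycles A E) where
  ground := rfl
  indep_iff I hI := by
    rw [vectorMatroid_indep, linearIndepOn_zmod_two_iff]
    simp only [Finset.coe_subset, hI, true_and]
    exact ⟨fun h s hs hsI => h s hsI hs.2, fun h s hsI hs => h s ⟨hsI.trans hI, hs⟩ hsI⟩

/-- Allows any finite set of rows, so it covers matrices with a splitting row: a splitting can only
fail by not being a gammoid. -/
theorem isBinary_vectorMatroid {α ρ : Type*} [Finite ρ] (A : Matrix ρ α (ZMod 2)) (E : Set α) :
    IsBinary (vectorMatroid A E) := by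
  have := Fintype.ofFinite ρ
  refine ⟨Fintype.card ρ, A.submatrix (Fintype.equivFin ρ).symm id, ?_⟩
  refine Matroid.ext_indep rfl fun I hI => ?_
  simp only [vectorMatroid_indep, vectorMatroid_ground, linearIndepOn_zmod_two_iff]
  refine and_congr_right fun _ => forall_congr' fun t => forall_congr' fun _ => ?_
  have : ∑ e ∈ t, A.col e = 0 ↔
      ∑ e ∈ t, (A.submatrix (Fintype.equivFin ρ).symm id).col e = 0 := by
    simp only [funext_iff, Finset.sum_apply, Matrix.col_apply, Matrix.submatrix_apply, id,
      Pi.zero_apply]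
    exact (Fintype.equivFin ρ).symm.surjective.forall
  rw [this]

/-- The contraction of `Y` restricted to the range of `φ`, when its cycles are given by `K`. -/
theorem HasCycles.indep_minor_iff {α ι : Type*} [DecidableEq α] {M : Matroid α} {E : Finset α}
    {C : Set (Finset α)} (h : HasCycles M E C) (hC : IsCycleSpace E C) {Y : Finset α} (hYE : Y ⊆ E)
    (φ : ι ↪ α) (hφ : ∀ i, φ i ∈ E ∧ φ i ∉ Y) {K : Finset ι → Prop}
    (hK : ∀ t, (∃ s ∈ C, s \ Y = t.map φ) ↔ K t) (T : Finset ι) :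
    (M ／ (Y : Set α)).Indep (T.map φ : Finset α) ↔ ∀ u ⊆ T, K u → u = ∅ := by
  obtain ⟨J, hJ⟩ := M.exists_isBasis (Y : Set α) (by rw [h.ground]; exact_mod_cast hYE)
  have hJY := hJ.subset
  lift J to Finset α using Y.finite_toSet.subset hJY
  have hJY' := Finset.coe_subset.1 hJY
  have hTE : T.map φ ⊆ E := fun x hx => by
    obtain ⟨i, -, rfl⟩ := Finset.mem_map.1 hx
    exact (hφ i).1
  have hdisj : Disjoint ((T.map φ : Finset α) : Set α) (Y : Set α) := by
    rw [Finset.disjoint_coe, Finset.disjoint_left]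
    intro x hx
    obtain ⟨i, -, rfl⟩ := Finset.mem_map.1 hx
    exact (hφ i).2
  rw [hJ.contract_indep_iff, ← Finset.coe_union,
    h.indep_iff _ (Finset.union_subset hTE (hJY'.trans hYE)),
    isAcyclic_map_union_iff hC hJY' ((h.indep_iff _ (hJY'.trans hYE)).1 hJ.indep)
      (fun y hy hyJ hac => ?_) φ (fun i => (hφ i).2) hK]
  · exact and_iff_left hdisj.symm
  · rw [← h.indep_iff _ (Finset.insert_subset (hYE hy) (hJY'.trans hYE))] at hac
    exact hyJ (by
      have := hJ.mem_of_insert_indep (e := y) (by exact_mod_cast hy) (by simpa using hac)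
      exact_mod_cast this)

/-! ### Elementary quotients of `M(K₄)` -/

/-- Columns of the incidence matrix of `Q₂`. -/
def q2 : Fin 6 → Fin 3 → ZMod 2 :=
  ![![0, 1, 1], ![1, 1, 0], ![1, 1, 0], ![1, 0, 1], ![1, 0, 1], ![0, 0, 0]]

/-- Columns of the incidence matrix of `Q₄`. -/
def q4 : Fin 6 → Fin 3 → ZMod 2 :=
  ![![0, 1, 1], ![0, 1, 1], ![1, 1, 0], ![1, 1, 0], ![1, 0, 1], ![1, 0, 1]]

theorem incMatrix_Q₂_col (i : Fin 6) : (incMatrix Q₂).col i = q2 i := by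
  have h (x y : Fin 3) (h : Q₂.IsLink i x y) := incMatrix_col_of_isLink Q₂ h
  fin_cases i
  · rw [h 1 2 rfl]; decide
  · rw [h 0 1 rfl]; decide
  · rw [h 0 1 rfl]; decide
  · rw [h 0 2 rfl]; decide
  · rw [h 0 2 rfl]; decide
  · rw [h 0 0 rfl]; decide

theorem incMatrix_Q₄_col (i : Fin 6) : (incMatrix Q₄).col i = q4 i := by
  have h (x y : Fin 3) (h : Q₄.IsLink i x y) := incMatrix_col_of_isLink Q₄ h
  fin_cases i
  · rw [h 1 2 rfl]; decide
  · rw [h 1 2 rfl]; decide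
  · rw [h 0 1 rfl]; decide
  · rw [h 0 1 rfl]; decide
  · rw [h 0 2 rfl]; decide
  · rw [h 0 2 rfl]; decide

/-- Factoring a nonzero vector out of the representation of `M(K₄)` gives a representation of
`M(Q₂)` or of `M(Q₄)`. -/
theorem exists_relabelling (w : ZMod 2 × ZMod 2 × ZMod 2) (hw : w ≠ 0) :
    (∃ τ ∈ ([![5, 1, 3, 2, 4, 0], ![4, 0, 3, 2, 5, 1], ![3, 0, 4, 1, 5, 2], ![2, 0, 1, 4, 5, 3],
        ![1, 0, 2, 3, 5, 4], ![0, 1, 2, 3, 4, 5]] : List (Fin 6 → Fin 6)),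
      Function.Injective τ ∧ ∀ t : Finset (Fin 6),
        (∑ i ∈ t, k4 (τ i) = 0 ∨ ∑ i ∈ t, k4 (τ i) = w) ↔ ∑ i ∈ t, q2 i = 0) ∨
    (∃ τ ∈ ([![0, 5, 1, 4, 2, 3]] : List (Fin 6 → Fin 6)),
      Function.Injective τ ∧ ∀ t : Finset (Fin 6),
        (∑ i ∈ t, k4 (τ i) = 0 ∨ ∑ i ∈ t, k4 (τ i) = w) ↔ ∑ i ∈ t, q4 i = 0) := by
  -- In the first list `τ 5` is the column equal to `w`, which becomes the loop of `Q₂`. The second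
  -- list serves `w = (1, 1, 1)`, the only nonzero vector that is not a column; it makes opposite
  -- edges of `K₄` parallel.
  revert w
  decide +kernel

/-! ### The minor of `M` that becomes `M(K₄)` after splitting -/

theorem iso_cycleMatroid {α V ι : Type*} [Finite V] [Finite ι] {P : Matroid α} (Q : Graph V ι)
    (hQ : Q.edgeSet = Set.univ) (ψ : ι ↪ α) (hE : P.E = Set.range ψ)
    (h : ∀ T : Finset ι, P.Indep (T.map ψ : Finset α) ↔
      ∀ u ⊆ T, ∑ i ∈ u, (incMatrix Q).col i = 0 → u = ∅) : Iso P (cycleMatroid Q) := by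
  classical
  have hbij : Function.Bijective (fun i : (cycleMatroid Q).E => (⟨ψ i, by simp [hE]⟩ : P.E)) := by
    constructor
    · intro i j hij
      exact Subtype.ext (ψ.injective (Subtype.ext_iff.1 hij))
    · rintro ⟨x, hx⟩
      obtain ⟨i, rfl⟩ := hE ▸ hx
      exact ⟨⟨i, by simp [hQ]⟩, rfl⟩
  refine ⟨(Equiv.ofBijective _ hbij).symm, fun I => ?_⟩
  set T : Set ι := Subtype.val '' ((Equiv.ofBijective _ hbij).symm '' I) with hT
  have hI : Subtype.val '' I = ψ '' T := by
    rw [hT, Set.image_image, Set.image_image]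
    refine Set.image_congr fun x _ => ?_
    exact congrArg Subtype.val ((Equiv.ofBijective _ hbij).apply_symm_apply x).symm
  clear_value T
  lift T to Finset ι using Set.toFinite T
  rw [hI, ← Finset.coe_map, h, cycleMatroid_indep, containsCycle_iff Q T (by simp [hQ]),
    linearIndepOn_zmod_two_iff]
  simp [hQ]

/-- A binary gammoid with a splitting that is not a binary gammoid has a minor isomorphic to the
cycle matroid of `Q₂` or `Q₄`. -/
theorem SplittingClass.exists_isMinor_iso {α : Type*} {M : Matroid α} {k : ℕ}
    (hM : SplittingClass k M) :
    ∃ P : Matroid α, P ≤m M ∧ (Iso P (cycleMatroid Q₂) ∨ Iso P (cycleMatroid Q₄)) := by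
  classical
  obtain ⟨⟨-, hgam⟩, H, -, -, N, ⟨m, A, hMA, rfl⟩, hN⟩ := hM
  obtain ⟨E, hE⟩ : ∃ E : Finset α, M.E = E := by
    -- Finiteness of the ground set comes from the finite digraph.
    obtain ⟨V, hV, D, B, f, hf, -⟩ := hgam
    have : M.E.Finite := Set.Finite.of_finite_image (Set.toFinite (f '' M.E)) hf
    exact ⟨this.toFinset, by simp⟩
  rw [hE] at hMA hN
  set C := vectorCycles A E with hCdef
  have hC : IsCycleSpace E C := isCycleSpace_vectorCycles A E
  have hMC : HasCycles M E C := hMA ▸ hasCycles_vectorMatroid A E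
  set χ : α → ZMod 2 := fun e => if e ∈ H then 1 else 0 with hχ
  have hsplit : ∀ s, s ∈ vectorCycles (addRow A H) E ↔ s ∈ C ∧ ∑ e ∈ s, χ e = 0 := by
    intro s
    simp [hCdef, vectorCycles, funext_iff, Finset.sum_apply, addRow, Matrix.col_apply, hχ, and_assoc]
  have hNK : HasK4Minor E (vectorCycles (addRow A H) E) := by
    by_contra hK
    exact hN ⟨isBinary_vectorMatroid _ _, (hasCycles_vectorMatroid _ E).isGammoid_iff.2
      (isGammoidSpace_of_not_hasK4Minor _ E _ rfl (isCycleSpace_vectorCycles _ E) hK)⟩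
  have hMK := (hMC.isGammoid_iff.1 hgam).not_hasK4Minor hC
  obtain ⟨φ, Y, hYE, hφ, hK⟩ := hNK
  simp only [hsplit] at hK
  -- Some cycle of `M` leaves a non-cycle of `K₄`; otherwise the same minor of the gammoid `M` would
  -- be `M(K₄)`.
  obtain ⟨u, ⟨s₀, hs₀, hs₀u⟩, hw⟩ : ∃ u : Finset (Fin 6), (∃ s ∈ C, s \ Y = u.map φ) ∧
      ∑ i ∈ u, k4 i ≠ 0 := by
    by_contra! hcon
    refine hMK ⟨φ, Y, hYE, hφ, fun t => ⟨hcon t, fun h => ?_⟩⟩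
    obtain ⟨s, hs, hst⟩ := (hK t).2 h
    exact ⟨s, hs.1, hst⟩
  have hmap : ∀ s t : Finset (Fin 6), (s ∆ t).map φ = s.map φ ∆ t.map φ := fun s t => by
    simp only [Finset.map_eq_image]; exact Finset.image_symmDiff s t φ.injective
  have hsdiff : ∀ s t : Finset α, (s ∆ t) \ Y = (s \ Y) ∆ (t \ Y) := fun s t => by
    ext x; simp only [Finset.mem_symmDiff, Finset.mem_sdiff]; tauto
  have htwo : ∀ x : ZMod 2, x = 0 ∨ x = 1 := by decide
  have hodd : ∑ e ∈ s₀, χ e = 1 := (htwo _).resolve_left fun h => hw ((hK u).1 ⟨s₀, ⟨hs₀, h⟩, hs₀u⟩)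
  set w := ∑ i ∈ u, k4 i with hwdef
  -- Adding `s₀`, which meets `H` oddly, exchanges even and odd cycles of `M`. So the odd ones
  -- contribute exactly the sets with sum `w`.
  have hD : ∀ t : Finset (Fin 6), (∃ s ∈ C, s \ Y = t.map φ) ↔
      ∑ i ∈ t, k4 i = 0 ∨ ∑ i ∈ t, k4 i = w := by
    intro t
    have hsum : ∑ i ∈ t ∆ u, k4 i = 0 ↔ ∑ i ∈ t, k4 i = w := by
      rw [sum_symmDiff_zmod_two, ← hwdef]
      generalize ∑ i ∈ t, k4 i = x
      generalize w = y
      revert x y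
      decide +kernel
    rw [← hsum, ← hK, ← hK]
    constructor
    · rintro ⟨s, hs, hst⟩
      rcases htwo (∑ e ∈ s, χ e) with h | h
      · exact Or.inl ⟨s, ⟨hs, h⟩, hst⟩
      · refine Or.inr ⟨s ∆ s₀, ⟨hC.symmDiff_mem s hs s₀ hs₀, ?_⟩, ?_⟩
        · rw [sum_symmDiff_zmod_two, h, hodd]; rfl
        · rw [hsdiff, hst, hs₀u, hmap]
    · rintro (⟨s, hs, hst⟩ | ⟨s, hs, hst⟩)
      · exact ⟨s, hs.1, hst⟩
      · refine ⟨s ∆ s₀, hC.symmDiff_mem s hs.1 s₀ hs₀, ?_⟩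
        rw [hsdiff, hst, hs₀u, ← hmap, symmDiff_symmDiff_cancel_right]
  have hrange : ((E : Set α) \ Y) \ (E \ Set.range φ) = Set.range φ := by
    ext x
    simp only [Set.mem_sdiff, Finset.mem_coe, Set.mem_range]
    constructor
    · tauto
    · rintro ⟨i, rfl⟩
      exact ⟨hφ i, fun h => h.2 ⟨i, rfl⟩⟩
  refine ⟨M ／ (Y : Set α) ＼ ((E : Set α) \ Set.range φ), Matroid.contract_delete_isMinor _ _ _, ?_⟩
  have hiso : ∀ (Q : Graph (Fin 3) (Fin 6)) (q : Fin 6 → Fin 3 → ZMod 2) (τ : Fin 6 → Fin 6),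
      Q.edgeSet = Set.univ → (∀ i, (incMatrix Q).col i = q i) → Function.Injective τ →
      (∀ t : Finset (Fin 6), (∑ i ∈ t, k4 (τ i) = 0 ∨ ∑ i ∈ t, k4 (τ i) = w) ↔
        ∑ i ∈ t, q i = 0) →
      Iso (M ／ (Y : Set α) ＼ ((E : Set α) \ Set.range φ)) (cycleMatroid Q) := by
    intro Q q τ hQ hq hτ hτq
    have hτr : Set.range (φ ∘ τ) = Set.range φ :=
      (Finite.surjective_of_injective hτ).range_comp φ
    refine iso_cycleMatroid Q hQ (Function.Embedding.trans ⟨τ, hτ⟩ φ) ?_ fun T => ?_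
    · rw [Matroid.delete_ground, Matroid.contract_ground, hE, hrange]
      exact hτr.symm
    · rw [Matroid.delete_indep_iff, and_iff_left, hMC.indep_minor_iff hC hYE _ (fun i => hφ (τ i))]
      · intro t
        simp only [hq, ← hτq]
        rw [← Finset.map_map, hD]
        simp
      · rw [Set.disjoint_left]
        intro x hx hx'
        obtain ⟨i, -, rfl⟩ := Finset.mem_map.1 (Finset.mem_coe.1 hx)
        exact hx'.2 ⟨τ i, rfl⟩
  rcases exists_relabelling w hw with ⟨τ, -, hτ, h⟩ | ⟨τ, -, hτ, h⟩
  · exact Or.inl (hiso Q₂ q2 τ rfl incMatrix_Q₂_col hτ h)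
  · exact Or.inr (hiso Q₄ q4 τ rfl incMatrix_Q₄_col hτ h)

end GammoidSplitting

theorem theorem1p4 {α : Type*} (M : Matroid α) (k : ℕ) (hk : 2 ≤ k)
    (hM : GammoidSplitting.SplittingClass k M) :
    ∃ P : Matroid α, P ≤m M ∧
      ((∃ N : Matroid α, GammoidSplitting.IsMinimalInSplittingClass (k - 1) N ∧
          ∃ e ∈ P.E, GammoidSplitting.Iso (P ＼ {e}) N) ∨
        ∃ Q : Graph (Fin 3) (Fin 6),
          (Q = GammoidSplitting.Q₂ ∨ Q = GammoidSplitting.Q₃ ∨ Q = GammoidSplitting.Q₄) ∧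
            (GammoidSplitting.Iso P (GammoidSplitting.cycleMatroid Q) ∨
              ∃ X ⊆ P.E, X.encard ≤ k ∧
                GammoidSplitting.Iso (P ＼ X) (GammoidSplitting.cycleMatroid Q))) := by
  obtain ⟨P, hPM, hP⟩ := hM.exists_isMinor_iso
  rcases hP with hP | hP
  · exact ⟨P, hPM, Or.inr ⟨GammoidSplitting.Q₂, Or.inl rfl, Or.inl hP⟩⟩
  · exact ⟨P, hPM, Or.inr ⟨GammoidSplitting.Q₄, Or.inr (Or.inr rfl), Or.inl hP⟩⟩
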